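/- Let $R$ be a commutative Noetherian Henselian local ring; all modules below are finitely generated $R$-modules, and $(-)^*=\mathrm{Hom}_R(-,R)$. A module $X$ is G-projective if the natural map $X\to X^{**}$ is an isomorphism and $\mathrm{Ext}^i_R(X,R)=0=\mathrm{Ext}^i_R(X^*,R)$ for all $i>0$; let $\mathcal G$ be the full subcategory of G-projective modules. A right $\mathcal G$-approximation of a module $M$ is a homomorphism $\phi:X\to M$ with $X\in\mathcal G$ such that every homomorphism $X'\to M$ with $X'\in\mathcal G$ factors through $\phi$. For modules $M,N$ let $\underline{\mathrm{Hom}}_R(M,N)$ be the quotient of $\mathrm{Hom}_R(M,N)$ by the homomorphisms that factor through a free module; the stable category $\underline{\mathcal G}$ has the same objects as $\mathcal G$ and these groups as groups of morphisms. Let $\Omega M$ be the kernel of a minimal right approximation $F\to M$ of $M$ by free modules (its minimal free cover) and $\Omega^{-1}M$ the cokernel of a minimal left approximation $M\to F$ of $M$ by free modules. Both $\Omega$ and $\Omega^{-1}$ are functors on the stable category of all modules, and for $n\ge 1$ we write $\Omega^{n}$ and $\Omega^{-n}$ for their $n$-fold iterates, with $\Omega^0=\mathrm{id}$. For $i\in\mathbb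 Z$, $X\in\mathcal G$ and a module $M$, set $\widehat{\mathrm{Ext}}{}^i_R(X,M)=\underline{\mathrm{Hom}}_R(\Omega^iX,M)$ (Tate cohomology). For a preadditive category $\mathcal A$, a right $\mathcal A$-module is an additive contravariant functor $F$ from $\mathcal A$ to abelian groups; it is finitely generated if there is an exact sequence $\mathrm{Hom}_{\mathcal A}(-,X)\to F\to 0$ with $X\in\mathcal A$, and finitely presented if there is an exact sequence $\mathrm{Hom}_{\mathcal A}(-,X_1)\to\mathrm{Hom}_{\mathcal A}(-,X_0)\to F\to 0$ with $X_0,X_1\in\mathcal A$. Let $\mathrm{mod}\,\mathcal A$ be the category of finitely presented right $\mathcal A$-modules, with all natural transformations as morphisms. **Theorem.** For a finitely generated $R$-module $M$ the following are equivalent: 1. $M$ has a right $\mathcal G$-approximation; 2. $\widehat{\mathrm{Ext}}{}^i_R(-,M)|_{\underline{\mathcal G}}$ is a finitely generated right $\underline{\mathcal G}$-module for every $i\in\mathbb Z$; 3. $\widehat{\mathrm{Ext}}{}^i_R(-,M)|_{\underline{\mathcal G}}$ is a finitely generated right $\underline{\mathcal G}$-module for some $i\in\mathbb Z$; 4. $\widehat{\mathrm{Ext}}{}^i_R(-,M)|_{\underline{\mathcal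 G}}$ is a finitely presented right $\underline{\mathcal G}$-module for every $i\in\mathbb Z$; 5. $\widehat{\mathrm{Ext}}{}^i_R(-,M)|_{\underline{\mathcal G}}$ is a finitely presented right $\underline{\mathcal G}$-module for some $i\in\mathbb Z$; 6. $\widehat{\mathrm{Ext}}{}^i_R(-,M)|_{\underline{\mathcal G}}$ is a projective object of $\mathrm{mod}\,\underline{\mathcal G}$ for every $i\in\mathbb Z$; 7. $\widehat{\mathrm{Ext}}{}^i_R(-,M)|_{\underline{\mathcal G}}$ is a projective object of $\mathrm{mod}\,\underline{\mathcal G}$ for some $i\in\mathbb Z$. -/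

import Mathlib

universe w v u

open CategoryTheory Opposite

noncomputable section

/-! ### Approximations by a subcategory -/

section Approximations

variable {C : Type u} [Category.{v} C]

/-- `φ : X ⟶ M` is a right `P`-approximation (a `P`-precover) of `M`. -/
def IsRightApproximation (P : ObjectProperty C) {X M : C} (φ : X ⟶ M) : Prop :=
  P X ∧ ∀ ⦃X' : C⦄, P X' → ∀ φ' : X' ⟶ M, ∃ f : X' ⟶ X, f ≫ φ = φ'

/-- `φ : M ⟶ X` is a left `P`-approximation (a `P`-preenvelope) of `M`. -/
def IsLeftApproximation (P : ObjectProperty C) {M X : C} (φ : M ⟶ X) : Prop :=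
  P X ∧ ∀ ⦃X' : C⦄, P X' → ∀ φ' : M ⟶ X', ∃ f : X ⟶ X', φ ≫ f = φ'

/-- `φ` is right minimal: every endomorphism `f` of the source with `φ f = φ` is invertible. -/
def IsRightMinimal {X M : C} (φ : X ⟶ M) : Prop :=
  ∀ f : X ⟶ X, f ≫ φ = φ → IsIso f

/-- `φ` is left minimal: every endomorphism `f` of the target with `f φ = φ` is invertible. -/
def IsLeftMinimal {M X : C} (φ : M ⟶ X) : Prop :=
  ∀ f : X ⟶ X, φ ≫ f = φ → IsIso f

/-- The subcategory of the objects that have a right `P`-approximation. -/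
def rap (P : ObjectProperty C) : ObjectProperty C :=
  fun M => ∃ (X : C) (φ : X ⟶ M), IsRightApproximation P φ

end Approximations

/-! ### Modules over a preadditive category -/

section FunctorCategory

/-- The right functor category `Mod A`: additive contravariant functors from `A` to
abelian groups. -/
abbrev RightMod (A : Type u) [Category.{v} A] [Preadditive A] :=
  Aᵒᵖ ⥤+ AddCommGrpCat.{v}

variable {A : Type u} [Category.{v} A] [Preadditive A]

namespace RightMod

/-- The right module `Hom_A(-, X)`. -/
abbrev representable (X : A) : RightMod A :=
  AdditiveFunctor.of (preadditiveYoneda.obj X)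

/-- Surjectivity of a morphism of right modules, i.e. exactness of `F ⟶ G ⟶ 0`. -/
def Surj {F G : RightMod A} (g : F ⟶ G) : Prop :=
  ∀ Y : Aᵒᵖ, Function.Surjective (g.hom.app Y)

/-- Exactness of `F ⟶ G ⟶ H` in the functor category, which is computed objectwise. -/
def Exact {F G H : RightMod A} (f : F ⟶ G) (g : G ⟶ H) : Prop :=
  ∀ Y : Aᵒᵖ, Function.Exact (f.hom.app Y) (g.hom.app Y)

/-- There is an exact sequence `Hom_A(-, X) ⟶ F ⟶ 0`. -/
def finitelyGenerated : ObjectProperty (RightMod A) :=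
  fun F => ∃ (X : A) (g : representable X ⟶ F), Surj g

/-- There is an exact sequence `Hom_A(-, X₁) ⟶ Hom_A(-, X₀) ⟶ F ⟶ 0`. -/
def finitelyPresented : ObjectProperty (RightMod A) :=
  fun F => ∃ (X₁ X₀ : A) (f : representable X₁ ⟶ representable X₀) (g : representable X₀ ⟶ F),
    Exact f g ∧ Surj g

/-- `F` is an object of the category `mod A` of finitely presented right modules, and it is
projective in that category. -/
def projectiveInFP : ObjectProperty (RightMod A) :=
  fun F => ∃ h : finitelyPresented F,
    Projective (⟨F, h⟩ : (finitelyPresented (A := A)).FullSubcategory)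

end RightMod

end FunctorCategory

/-! ### The stable category -/

section Stable

variable (R : Type u) [CommRing R]

/-- The finitely generated free modules. -/
def freeMod : ObjectProperty (FGModuleCat.{u} R) := fun X => Module.Free R X

variable {R} in
/-- `f` factors through some (finitely generated) free module. -/
def FactorsThroughFree {X Y : FGModuleCat.{u} R} (f : X ⟶ Y) : Prop :=
  ∃ (F : FGModuleCat.{u} R) (_ : freeMod R F) (a : X ⟶ F) (b : F ⟶ Y), a ≫ b = f

namespace FactorsThroughFree

variable {R} {X Y Z : FGModuleCat.{u} R}

lemma zero : FactorsThroughFree (0 : X ⟶ Y) :=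
  ⟨FGModuleCat.of R R, inferInstanceAs (Module.Free R R), 0, 0, by simp⟩

lemma neg {f : X ⟶ Y} (hf : FactorsThroughFree f) : FactorsThroughFree (-f) := by
  obtain ⟨F, hF, a, b, rfl⟩ := hf
  exact ⟨F, hF, a, -b, by simp⟩

lemma comp_left {g : Y ⟶ Z} (f : X ⟶ Y) (hg : FactorsThroughFree g) :
    FactorsThroughFree (f ≫ g) := by
  obtain ⟨F, hF, a, b, rfl⟩ := hg
  exact ⟨F, hF, f ≫ a, b, by simp⟩

lemma comp_right {f : X ⟶ Y} (g : Y ⟶ Z) (hf : FactorsThroughFree f) :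
    FactorsThroughFree (f ≫ g) := by
  obtain ⟨F, hF, a, b, rfl⟩ := hf
  exact ⟨F, hF, a, b ≫ g, by simp⟩

lemma add {f g : X ⟶ Y} (hf : FactorsThroughFree f) (hg : FactorsThroughFree g) :
    FactorsThroughFree (f + g) := by
  obtain ⟨F, hF, a, b, rfl⟩ := hf
  obtain ⟨G, hG, c, d, rfl⟩ := hg
  have : Module.Free R F := hF
  have : Module.Free R G := hG
  refine ⟨FGModuleCat.of R (F × G), inferInstanceAs (Module.Free R (F × G)),
    FGModuleCat.ofHom (a.hom.hom.prod c.hom.hom),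
    FGModuleCat.ofHom (b.hom.hom.coprod d.hom.hom), ?_⟩
  ext x
  rfl

end FactorsThroughFree

/-- Two morphisms are identified in the stable category when their difference factors
through a free module. -/
def stableRel : HomRel (FGModuleCat.{u} R) := fun _ _ f g => FactorsThroughFree (f - g)

instance : Congruence (stableRel R) where
  equivalence :=
    { refl := fun f => by simpa [stableRel] using FactorsThroughFree.zero
      symm := fun {f g} h => by simpa [stableRel] using FactorsThroughFree.neg h
      trans := fun {f g k} h h' => by simpa [stableRel] using FactorsThroughFree.add h h' }
  comp_left f _ _ h := by
    simpa [stableRel, Preadditive.comp_sub] using FactorsThroughFree.comp_left f h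
  comp_right g h := by
    simpa [stableRel, Preadditive.sub_comp] using FactorsThroughFree.comp_right g h

/-- The stable category of the category of finitely generated modules. -/
abbrev StableMod := CategoryTheory.Quotient (stableRel R)

instance : Preadditive (StableMod R) :=
  CategoryTheory.Quotient.preadditive _ (fun _ _ f₁ f₂ g₁ g₂ hf hg => by
    have := FactorsThroughFree.add hf hg
    rwa [sub_add_sub_comm] at this)

/-- The projection from modules to the stable category. -/
abbrev toStable : FGModuleCat.{u} R ⥤ StableMod R := CategoryTheory.Quotient.functor (stableRel R)

instance : (toStable R).Additive := CategoryTheory.Quotient.functor_additive _ _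

variable {R} in
/-- The stable category of a subcategory of modules: it has the same objects, and the morphisms
are those of the stable category of all modules. -/
abbrev StableCat (P : ObjectProperty (FGModuleCat.{u} R)) :=
  ObjectProperty.FullSubcategory (fun X : StableMod R => P X.as)

end Stable

/-! ### Minimal free approximations -/

section Minimal

lemma FGModuleCat.isIso_of_bijective {R : Type u} [CommRing R] {X Y : FGModuleCat.{u} R} (f : X ⟶ Y)
    (hf : Function.Bijective f.hom.hom) : IsIso f := by
  let e := LinearEquiv.ofBijective f.hom.hom hf
  refine ⟨FGModuleCat.ofHom e.symm.toLinearMap, ?_, ?_⟩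
  · ext x
    exact e.symm_apply_apply x
  · ext x
    exact e.apply_symm_apply x

open IsLocalRing TensorProduct

/-- Existence of a generating system that is minimal, in the form of a rigidity property. -/
lemma exists_minimal_generators {R : Type u} [CommRing R] [IsLocalRing R] (M : Type u) [AddCommGroup M] [Module R M] [Module.Finite R M] :
    ∃ (n : ℕ) (m : Fin n → M), Submodule.span R (Set.range m) = ⊤ ∧
      ∀ G : Matrix (Fin n) (Fin n) R, (∀ i, ∑ j, G i j • m j = m i) → IsUnit G := by
  let k := ResidueField R
  let b := Module.finBasis k (k ⊗[R] M)
  have hs : Function.Surjective (TensorProduct.mk R k M 1) :=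
    TensorProduct.mk_surjective R M k Ideal.Quotient.mk_surjective
  choose m hm using fun i => hs (b i)
  refine ⟨_, m, span_eq_top_of_tmul_eq_basis m b hm, fun G hG => ?_⟩
  have h1 : G.map (algebraMap R k) = 1 := by
    ext i j
    have h2 : ∑ j, (algebraMap R k (G i j)) • b j = b i := by
      rw [← hm i, ← hG i, map_sum]
      refine Finset.sum_congr rfl fun j _ => ?_
      rw [map_smul, ← hm j, algebraMap_smul]
    have h3 := congrArg (fun x => b.repr x j) h2
    simp only [map_sum, map_smul, Finsupp.coe_finsetSum, Finset.sum_apply, Finsupp.smul_apply,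
      Module.Basis.repr_self, Finsupp.single_apply, smul_eq_mul, mul_ite, mul_one, mul_zero,
      Finset.sum_ite_eq', Finset.mem_univ, if_true] at h3
    rw [Matrix.map_apply, h3, Matrix.one_apply]
  rw [Matrix.isUnit_iff_isUnit_det]
  refine (isUnit_map_iff (residue R) _).1 ?_
  have h4 : residue R G.det = (G.map (algebraMap R k)).det := by
    rw [← RingHom.mapMatrix_apply, ← RingHom.map_det]
    rfl
  rw [h4, h1, Matrix.det_one]
  exact isUnit_one

/-- Every module has a minimal right approximation by free modules. -/
lemma exists_minimal_right_free_approximation {R : Type u} [CommRing R] [IsLocalRing R]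
    (M : FGModuleCat.{u} R) :
    ∃ (F : FGModuleCat.{u} R) (π : F ⟶ M),
      IsRightApproximation (freeMod R) π ∧ IsRightMinimal π := by
  obtain ⟨n, m, hm, hG⟩ := exists_minimal_generators (R := R) M
  let l : (Fin n → R) →ₗ[R] M := Fintype.linearCombination R m
  have hl : Function.Surjective l := by
    rw [← LinearMap.range_eq_top, Fintype.range_linearCombination, hm]
  refine ⟨FGModuleCat.of R (Fin n → R), FGModuleCat.ofHom l,
    ⟨inferInstanceAs (Module.Free R (Fin n → R)), fun X' hX' φ' => ?_⟩, fun f hf => ?_⟩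
  · have : Module.Free R X' := hX'
    obtain ⟨h, hh⟩ := Module.projective_lifting_property l φ'.hom.hom hl
    exact ⟨FGModuleCat.ofHom h, by ext x; exact LinearMap.congr_fun hh x⟩
  · let g : (Fin n → R) →ₗ[R] (Fin n → R) := f.hom.hom
    have hg : ∀ x, l (g x) = l x := fun x =>
      LinearMap.congr_fun (congrArg (fun t => t.hom.hom) hf) x
    have hu : IsUnit (LinearMap.toMatrix' g).transpose := hG _ fun i => by
      have h1 := hg (Pi.single i 1)
      simpa [l, Fintype.linearCombination_apply, LinearMap.toMatrix'_apply, Pi.single_apply]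
        using h1
    rw [Matrix.isUnit_transpose] at hu
    have hu' : IsUnit g := by
      have := hu.map (Matrix.toLinAlgEquiv' (R := R) (n := Fin n))
      simpa using this
    exact FGModuleCat.isIso_of_bijective f ((Module.End.isUnit_iff g).1 hu')

/-- Every module has a minimal left approximation by free modules. -/
lemma exists_minimal_left_free_approximation {R : Type u} [CommRing R] [IsNoetherianRing R]
    [IsLocalRing R] (M : FGModuleCat.{u} R) :
    ∃ (F : FGModuleCat.{u} R) (θ : M ⟶ F),
      IsLeftApproximation (freeMod R) θ ∧ IsLeftMinimal θ := by
  obtain ⟨n, m, hm, hG⟩ := exists_minimal_generators (R := R) (Module.Dual R M)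
  refine ⟨FGModuleCat.of R (Fin n → R), FGModuleCat.ofHom (LinearMap.pi m),
    ⟨inferInstanceAs (Module.Free R (Fin n → R)), fun X' hX' φ' => ?_⟩, fun f hf => ?_⟩
  · have : Module.Free R X' := hX'
    let b := Module.Free.chooseBasis R X'
    have hc : ∀ i, ∃ c : Fin n → R, ∑ j, c j • m j = (b.coord i).comp φ'.hom.hom := fun i =>
      (Submodule.mem_span_range_iff_exists_fun R).1 (hm ▸ Submodule.mem_top)
    choose c hc using hc
    refine ⟨FGModuleCat.ofHom
      (∑ i, (∑ j, c i j • LinearMap.proj (R := R) (φ := fun _ : Fin n => R) j).smulRight (b i)),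
      ?_⟩
    ext x
    have h1 : ∀ i, ∑ j, c i j * m j x = b.repr (φ'.hom.hom x) i := fun i => by
      simpa using LinearMap.congr_fun (hc i) x
    change (∑ i, (∑ j, c i j • LinearMap.proj (R := R) (φ := fun _ : Fin n => R) j).smulRight
      (b i)) (LinearMap.pi m x) = φ'.hom.hom x
    simp only [LinearMap.sum_apply, LinearMap.smulRight_apply, LinearMap.smul_apply,
      LinearMap.proj_apply, LinearMap.pi_apply, smul_eq_mul, h1]
    exact b.sum_repr _
  · let g : (Fin n → R) →ₗ[R] (Fin n → R) := f.hom.hom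
    have hg : ∀ x, g (LinearMap.pi m x) = LinearMap.pi m x := fun x =>
      LinearMap.congr_fun (congrArg (fun t => t.hom.hom) hf) x
    have hu : IsUnit (LinearMap.toMatrix' g) := hG _ fun i => by
      ext x
      have h1 := congrFun (hg x) i
      rw [← LinearMap.toMatrix'_mulVec] at h1
      simpa [Matrix.mulVec, dotProduct] using h1
    have hu' : IsUnit g := by
      have := hu.map (Matrix.toLinAlgEquiv' (R := R) (n := Fin n))
      simpa using this
    exact FGModuleCat.isIso_of_bijective f ((Module.End.isUnit_iff g).1 hu')

end Minimal

/-! ### Syzygies and cosyzygies -/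

section Syzygy

variable {R : Type u} [CommRing R] [IsNoetherianRing R] [IsLocalRing R]

/-- The minimal right approximation of `M` by free modules: the source. -/
def freeCover (M : FGModuleCat.{u} R) : FGModuleCat.{u} R :=
  (exists_minimal_right_free_approximation M).choose

/-- The minimal right approximation of `M` by free modules: the map. -/
def freeCoverMap (M : FGModuleCat.{u} R) : freeCover M ⟶ M :=
  (exists_minimal_right_free_approximation M).choose_spec.choose

lemma freeCoverMap_isRightApproximation (M : FGModuleCat.{u} R) :
    IsRightApproximation (freeMod R) (freeCoverMap M) :=
  (exists_minimal_right_free_approximation M).choose_spec.choose_spec.1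

lemma freeCoverMap_isRightMinimal (M : FGModuleCat.{u} R) : IsRightMinimal (freeCoverMap M) :=
  (exists_minimal_right_free_approximation M).choose_spec.choose_spec.2

/-- The minimal left approximation of `M` by free modules: the target. -/
def freeEnvelope (M : FGModuleCat.{u} R) : FGModuleCat.{u} R :=
  (exists_minimal_left_free_approximation M).choose

/-- The minimal left approximation of `M` by free modules: the map. -/
def freeEnvelopeMap (M : FGModuleCat.{u} R) : M ⟶ freeEnvelope M :=
  (exists_minimal_left_free_approximation M).choose_spec.choose

lemma freeEnvelopeMap_isLeftApproximation (M : FGModuleCat.{u} R) :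
    IsLeftApproximation (freeMod R) (freeEnvelopeMap M) :=
  (exists_minimal_left_free_approximation M).choose_spec.choose_spec.1

lemma freeEnvelopeMap_isLeftMinimal (M : FGModuleCat.{u} R) :
    IsLeftMinimal (freeEnvelopeMap M) :=
  (exists_minimal_left_free_approximation M).choose_spec.choose_spec.2

/-- The first syzygy `Ω M`: the kernel of the minimal right free approximation. -/
def syzygyObj (M : FGModuleCat.{u} R) : FGModuleCat.{u} R :=
  FGModuleCat.of R (LinearMap.ker (freeCoverMap M).hom.hom)

/-- The inclusion of `Ω M` into the free cover of `M`. -/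
def syzygyι (M : FGModuleCat.{u} R) : syzygyObj M ⟶ freeCover M :=
  FGModuleCat.ofHom (LinearMap.ker (freeCoverMap M).hom.hom).subtype

/-- The first cosyzygy `Ω⁻¹ M`: the cokernel of the minimal left free approximation. -/
def cosyzygyObj (M : FGModuleCat.{u} R) : FGModuleCat.{u} R :=
  FGModuleCat.of R (freeEnvelope M ⧸ LinearMap.range (freeEnvelopeMap M).hom.hom)

/-- The projection from the free envelope of `M` onto `Ω⁻¹ M`. -/
def cosyzygyπ (M : FGModuleCat.{u} R) : freeEnvelope M ⟶ cosyzygyObj M :=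
  FGModuleCat.ofHom (LinearMap.range (freeEnvelopeMap M).hom.hom).mkQ

lemma syzygyι_comp (M : FGModuleCat.{u} R) : syzygyι M ≫ freeCoverMap M = 0 := by
  ext x
  exact x.2

lemma exists_lift_syzygyι {X M : FGModuleCat.{u} R} (a : X ⟶ freeCover M)
    (ha : a ≫ freeCoverMap M = 0) : ∃ b : X ⟶ syzygyObj M, b ≫ syzygyι M = a :=
  ⟨FGModuleCat.ofHom (LinearMap.codRestrict (LinearMap.ker (freeCoverMap M).hom.hom) a.hom.hom
    fun x => LinearMap.mem_ker.2
      (LinearMap.congr_fun (congrArg (fun t => t.hom.hom) ha :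
        (a ≫ freeCoverMap M).hom.hom = (0 : X ⟶ M).hom.hom) x)), rfl⟩

lemma syzygyι_cancel {X M : FGModuleCat.{u} R} {a b : X ⟶ syzygyObj M}
    (h : a ≫ syzygyι M = b ≫ syzygyι M) : a = b := by
  ext x
  exact Subtype.ext (LinearMap.congr_fun (congrArg (fun t => t.hom.hom) h) x)

lemma comp_cosyzygyπ (M : FGModuleCat.{u} R) : freeEnvelopeMap M ≫ cosyzygyπ M = 0 := by
  ext x
  exact (Submodule.Quotient.mk_eq_zero _).2 ⟨x, rfl⟩

lemma exists_desc_cosyzygyπ {M X : FGModuleCat.{u} R} (a : freeEnvelope M ⟶ X)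
    (ha : freeEnvelopeMap M ≫ a = 0) : ∃ b : cosyzygyObj M ⟶ X, cosyzygyπ M ≫ b = a :=
  ⟨FGModuleCat.ofHom (Submodule.liftQ _ a.hom.hom (by
    rintro _ ⟨x, rfl⟩
    exact LinearMap.congr_fun (congrArg (fun t => t.hom.hom) ha) x)), rfl⟩

lemma cosyzygyπ_cancel {M X : FGModuleCat.{u} R} {a b : cosyzygyObj M ⟶ X}
    (h : cosyzygyπ M ≫ a = cosyzygyπ M ≫ b) : a = b := by
  ext x
  obtain ⟨y, rfl⟩ := Submodule.mkQ_surjective _ x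
  exact LinearMap.congr_fun (congrArg (fun t => t.hom.hom) h) y

/-- `g : Ω M ⟶ Ω N` is the map on kernels in a commutative square lifting `f : M ⟶ N` to the
free covers. -/
def IsSyzygyMap {M N : FGModuleCat.{u} R} (f : M ⟶ N) (g : syzygyObj M ⟶ syzygyObj N) : Prop :=
  ∃ p : freeCover M ⟶ freeCover N,
    p ≫ freeCoverMap N = freeCoverMap M ≫ f ∧ g ≫ syzygyι N = syzygyι M ≫ p

/-- `h : Ω⁻¹ M ⟶ Ω⁻¹ N` is the map on cokernels in a commutative square extending `f : M ⟶ N`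
to the free envelopes. -/
def IsCosyzygyMap {M N : FGModuleCat.{u} R} (f : M ⟶ N)
    (h : cosyzygyObj M ⟶ cosyzygyObj N) : Prop :=
  ∃ p : freeEnvelope M ⟶ freeEnvelope N,
    freeEnvelopeMap M ≫ p = f ≫ freeEnvelopeMap N ∧ cosyzygyπ M ≫ h = p ≫ cosyzygyπ N

variable {L M N : FGModuleCat.{u} R}

lemma exists_isSyzygyMap (f : M ⟶ N) : ∃ g, IsSyzygyMap f g := by
  obtain ⟨p, hp⟩ := (freeCoverMap_isRightApproximation N).2
    (freeCoverMap_isRightApproximation M).1 (freeCoverMap M ≫ f)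
  obtain ⟨g, hg⟩ := exists_lift_syzygyι (syzygyι M ≫ p) (by
    rw [Category.assoc, hp, ← Category.assoc, syzygyι_comp, Limits.zero_comp])
  exact ⟨g, p, hp, hg⟩

lemma exists_isCosyzygyMap (f : M ⟶ N) : ∃ h, IsCosyzygyMap f h := by
  obtain ⟨p, hp⟩ := (freeEnvelopeMap_isLeftApproximation M).2
    (freeEnvelopeMap_isLeftApproximation N).1 (f ≫ freeEnvelopeMap N)
  obtain ⟨h, hh⟩ := exists_desc_cosyzygyπ (p ≫ cosyzygyπ N) (by
    rw [← Category.assoc, hp, Category.assoc, comp_cosyzygyπ, Limits.comp_zero])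
  exact ⟨h, p, hp, hh⟩

lemma IsSyzygyMap.id (M : FGModuleCat.{u} R) : IsSyzygyMap (𝟙 M) (𝟙 (syzygyObj M)) :=
  ⟨𝟙 _, by simp, by simp⟩

lemma IsCosyzygyMap.id (M : FGModuleCat.{u} R) : IsCosyzygyMap (𝟙 M) (𝟙 (cosyzygyObj M)) :=
  ⟨𝟙 _, by simp, by simp⟩

lemma IsSyzygyMap.comp {f : L ⟶ M} {f' : M ⟶ N} {g : syzygyObj L ⟶ syzygyObj M}
    {g' : syzygyObj M ⟶ syzygyObj N} (h : IsSyzygyMap f g) (h' : IsSyzygyMap f' g') :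
    IsSyzygyMap (f ≫ f') (g ≫ g') := by
  obtain ⟨p, h1, h2⟩ := h
  obtain ⟨q, h3, h4⟩ := h'
  refine ⟨p ≫ q, ?_, ?_⟩
  · rw [Category.assoc, h3, ← Category.assoc, h1, Category.assoc]
  · rw [Category.assoc, h4, ← Category.assoc, h2, Category.assoc]

lemma IsCosyzygyMap.comp {f : L ⟶ M} {f' : M ⟶ N} {g : cosyzygyObj L ⟶ cosyzygyObj M}
    {g' : cosyzygyObj M ⟶ cosyzygyObj N} (h : IsCosyzygyMap f g) (h' : IsCosyzygyMap f' g') :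
    IsCosyzygyMap (f ≫ f') (g ≫ g') := by
  obtain ⟨p, h1, h2⟩ := h
  obtain ⟨q, h3, h4⟩ := h'
  refine ⟨p ≫ q, ?_, ?_⟩
  · rw [← Category.assoc, h1, Category.assoc, h3, Category.assoc]
  · rw [← Category.assoc, h2, Category.assoc, h4, Category.assoc]

lemma IsSyzygyMap.add {f f' : M ⟶ N} {g g' : syzygyObj M ⟶ syzygyObj N}
    (h : IsSyzygyMap f g) (h' : IsSyzygyMap f' g') : IsSyzygyMap (f + f') (g + g') := by
  obtain ⟨p, h1, h2⟩ := h
  obtain ⟨q, h3, h4⟩ := h'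
  exact ⟨p + q, by simp [Preadditive.add_comp, Preadditive.comp_add, h1, h3],
    by simp [Preadditive.add_comp, Preadditive.comp_add, h2, h4]⟩

lemma IsCosyzygyMap.add {f f' : M ⟶ N} {g g' : cosyzygyObj M ⟶ cosyzygyObj N}
    (h : IsCosyzygyMap f g) (h' : IsCosyzygyMap f' g') : IsCosyzygyMap (f + f') (g + g') := by
  obtain ⟨p, h1, h2⟩ := h
  obtain ⟨q, h3, h4⟩ := h'
  exact ⟨p + q, by simp [Preadditive.add_comp, Preadditive.comp_add, h1, h3],
    by simp [Preadditive.add_comp, Preadditive.comp_add, h2, h4]⟩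

lemma IsSyzygyMap.sub {f f' : M ⟶ N} {g g' : syzygyObj M ⟶ syzygyObj N}
    (h : IsSyzygyMap f g) (h' : IsSyzygyMap f' g') : IsSyzygyMap (f - f') (g - g') := by
  obtain ⟨p, h1, h2⟩ := h
  obtain ⟨q, h3, h4⟩ := h'
  exact ⟨p - q, by simp [Preadditive.sub_comp, Preadditive.comp_sub, h1, h3],
    by simp [Preadditive.sub_comp, Preadditive.comp_sub, h2, h4]⟩

lemma IsCosyzygyMap.sub {f f' : M ⟶ N} {g g' : cosyzygyObj M ⟶ cosyzygyObj N}
    (h : IsCosyzygyMap f g) (h' : IsCosyzygyMap f' g') : IsCosyzygyMap (f - f') (g - g') := by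
  obtain ⟨p, h1, h2⟩ := h
  obtain ⟨q, h3, h4⟩ := h'
  exact ⟨p - q, by simp [Preadditive.sub_comp, Preadditive.comp_sub, h1, h3],
    by simp [Preadditive.sub_comp, Preadditive.comp_sub, h2, h4]⟩

lemma IsSyzygyMap.factorsThroughFree {f : M ⟶ N} {g : syzygyObj M ⟶ syzygyObj N}
    (h : IsSyzygyMap f g) (hf : FactorsThroughFree f) : FactorsThroughFree g := by
  obtain ⟨p, h1, h2⟩ := h
  obtain ⟨F, hF, a, b, rfl⟩ := hf
  obtain ⟨c, rfl⟩ := (freeCoverMap_isRightApproximation N).2 hF b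
  obtain ⟨s, hs⟩ := exists_lift_syzygyι (p - freeCoverMap M ≫ a ≫ c) (by
    simp [Preadditive.sub_comp, h1])
  refine ⟨freeCover M, (freeCoverMap_isRightApproximation M).1, syzygyι M, s,
    syzygyι_cancel ?_⟩
  rw [Category.assoc, hs, h2, Preadditive.comp_sub, ← Category.assoc (syzygyι M) (freeCoverMap M),
    syzygyι_comp, Limits.zero_comp, sub_zero]

lemma IsCosyzygyMap.factorsThroughFree {f : M ⟶ N} {g : cosyzygyObj M ⟶ cosyzygyObj N}
    (h : IsCosyzygyMap f g) (hf : FactorsThroughFree f) : FactorsThroughFree g := by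
  obtain ⟨p, h1, h2⟩ := h
  obtain ⟨F, hF, a, b, rfl⟩ := hf
  obtain ⟨c, rfl⟩ := (freeEnvelopeMap_isLeftApproximation M).2 hF a
  obtain ⟨s, hs⟩ := exists_desc_cosyzygyπ (p - c ≫ b ≫ freeEnvelopeMap N) (by
    simp [Preadditive.comp_sub, h1])
  refine ⟨freeEnvelope N, (freeEnvelopeMap_isLeftApproximation N).1, s, cosyzygyπ N,
    cosyzygyπ_cancel ?_⟩
  rw [← Category.assoc, hs, h2, Preadditive.sub_comp, Category.assoc, Category.assoc,
    comp_cosyzygyπ, Limits.comp_zero, Limits.comp_zero, sub_zero]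

lemma IsSyzygyMap.toStable_map_eq {f f' : M ⟶ N} {g g' : syzygyObj M ⟶ syzygyObj N}
    (h : IsSyzygyMap f g) (h' : IsSyzygyMap f' g') (hf : FactorsThroughFree (f - f')) :
    (toStable R).map g = (toStable R).map g' :=
  CategoryTheory.Quotient.sound _ ((h.sub h').factorsThroughFree hf)

lemma IsCosyzygyMap.toStable_map_eq {f f' : M ⟶ N} {g g' : cosyzygyObj M ⟶ cosyzygyObj N}
    (h : IsCosyzygyMap f g) (h' : IsCosyzygyMap f' g') (hf : FactorsThroughFree (f - f')) :
    (toStable R).map g = (toStable R).map g' :=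
  CategoryTheory.Quotient.sound _ ((h.sub h').factorsThroughFree hf)

variable (R)

/-- The syzygy functor, from modules to the stable category. -/
def syzygyAux : FGModuleCat.{u} R ⥤ StableMod R where
  obj M := (toStable R).obj (syzygyObj M)
  map f := (toStable R).map (exists_isSyzygyMap f).choose
  map_id M := ((exists_isSyzygyMap (𝟙 M)).choose_spec.toStable_map_eq (IsSyzygyMap.id M)
    (by simpa using FactorsThroughFree.zero)).trans ((toStable R).map_id _)
  map_comp f f' := ((exists_isSyzygyMap (f ≫ f')).choose_spec.toStable_map_eq
    ((exists_isSyzygyMap f).choose_spec.comp (exists_isSyzygyMap f').choose_spec)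
    (by simpa using FactorsThroughFree.zero)).trans ((toStable R).map_comp _ _)

/-- The cosyzygy functor, from modules to the stable category. -/
def cosyzygyAux : FGModuleCat.{u} R ⥤ StableMod R where
  obj M := (toStable R).obj (cosyzygyObj M)
  map f := (toStable R).map (exists_isCosyzygyMap f).choose
  map_id M := ((exists_isCosyzygyMap (𝟙 M)).choose_spec.toStable_map_eq (IsCosyzygyMap.id M)
    (by simpa using FactorsThroughFree.zero)).trans ((toStable R).map_id _)
  map_comp f f' := ((exists_isCosyzygyMap (f ≫ f')).choose_spec.toStable_map_eq
    ((exists_isCosyzygyMap f).choose_spec.comp (exists_isCosyzygyMap f').choose_spec)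
    (by simpa using FactorsThroughFree.zero)).trans ((toStable R).map_comp _ _)

/-- The syzygy functor `Ω` on the stable category. -/
def syzygy : StableMod R ⥤ StableMod R :=
  CategoryTheory.Quotient.lift _ (syzygyAux R) fun _ _ f f' h =>
    (exists_isSyzygyMap f).choose_spec.toStable_map_eq (exists_isSyzygyMap f').choose_spec h

/-- The cosyzygy functor `Ω⁻¹` on the stable category. -/
def cosyzygy : StableMod R ⥤ StableMod R :=
  CategoryTheory.Quotient.lift _ (cosyzygyAux R) fun _ _ f f' h =>
    (exists_isCosyzygyMap f).choose_spec.toStable_map_eq (exists_isCosyzygyMap f').choose_spec h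

instance : (syzygy R).Additive where
  map_add {X Y f g} := by
    obtain ⟨f, rfl⟩ := (toStable R).map_surjective f
    obtain ⟨g, rfl⟩ := (toStable R).map_surjective g
    exact (exists_isSyzygyMap (f + g)).choose_spec.toStable_map_eq
      ((exists_isSyzygyMap f).choose_spec.add (exists_isSyzygyMap g).choose_spec)
      (by simpa using FactorsThroughFree.zero)

instance : (cosyzygy R).Additive where
  map_add {X Y f g} := by
    obtain ⟨f, rfl⟩ := (toStable R).map_surjective f
    obtain ⟨g, rfl⟩ := (toStable R).map_surjective g
    exact (exists_isCosyzygyMap (f + g)).choose_spec.toStable_map_eq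
      ((exists_isCosyzygyMap f).choose_spec.add (exists_isCosyzygyMap g).choose_spec)
      (by simpa using FactorsThroughFree.zero)

/-- The `n`-fold iterate of an endofunctor. -/
def iterFunctor {C : Type w} [Category.{v} C] (F : C ⥤ C) : ℕ → C ⥤ C
  | 0 => 𝟭 C
  | n + 1 => iterFunctor F n ⋙ F

instance iterFunctor_additive {C : Type w} [Category.{v} C] [Preadditive C] (F : C ⥤ C)
    [F.Additive] (n : ℕ) : (iterFunctor F n).Additive := by
  induction n with
  | zero => exact inferInstanceAs (𝟭 C).Additive
  | succ n ih => exact inferInstanceAs (iterFunctor F n ⋙ F).Additive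

/-- The functor `Ωⁱ` on the stable category, for an arbitrary integer `i`: the `i`-th syzygy when
`i` is nonnegative and the `(-i)`-th cosyzygy when `i` is negative. -/
def syzygyPow : ℤ → StableMod R ⥤ StableMod R
  | Int.ofNat n => iterFunctor (syzygy R) n
  | Int.negSucc n => iterFunctor (cosyzygy R) (n + 1)

instance (i : ℤ) : (syzygyPow R i).Additive := by
  cases i with
  | ofNat n => exact iterFunctor_additive (syzygy R) n
  | negSucc n => exact iterFunctor_additive (cosyzygy R) (n + 1)

end Syzygy

/-! ### G-projective modules and Tate cohomology -/

section Tate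

variable (R : Type u) [CommRing R]

/-- The G-projective modules: the finitely generated modules `X` such that the natural map
`X → X**` is bijective and `Extⁱ(X, R) = 0 = Extⁱ(X*, R)` for all `i > 0`. -/
def GProj : ObjectProperty (FGModuleCat.{u} R) := fun X =>
  Function.Bijective (Module.Dual.eval R X) ∧
    (∀ i : ℕ, 0 < i → Subsingleton (Abelian.Ext X.obj (ModuleCat.of R R) i)) ∧
    (∀ i : ℕ, 0 < i →
      Subsingleton (Abelian.Ext (ModuleCat.of R (Module.Dual R X)) (ModuleCat.of R R) i))

variable {R} [IsNoetherianRing R] [IsLocalRing R]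

/-- The right module over the stable category of the G-projective modules given by the `i`-th Tate
cohomology: it sends `X` to the group of morphisms from `Ωⁱ X` to `M` in the stable category. -/
def tateExt (i : ℤ) (M : FGModuleCat.{u} R) : RightMod (StableCat (GProj R)) :=
  AdditiveFunctor.of ((ObjectProperty.ι (fun X : StableMod R => GProj R X.as)).op ⋙
    (syzygyPow R i).op ⋙ preadditiveYoneda.obj ((toStable R).obj M))

end Tate

end

/-!
Two of the implications carry the content; the others are immediate.

*From an approximation to projectivity.* Over a Henselian local ring idempotents of `R[f]` can be
found for an endomorphism `f` of a finitely generated module that split off the part on which `f`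
is invertible (`exists_isIdempotentElem_of_isIntegral`); the lift of the factorization of a
polynomial comes from an étale neighbourhood, which has a section by Hensel's lemma. Hence an
approximation `φ : X ⟶ M` can be taken right minimal (`exists_rightMinimal_approximation`). For
such `φ`, a map `k : Y ⟶ X` from a G-projective module with `φ k = 0` factors through a free module
(`factorsThroughFree_of_comp_eq_zero`, a form of Wakamatsu's lemma), so `φ` induces isomorphisms of
stable homomorphism groups out of G-projective modules (`stable_comp_bijective`). Since each power
of `Ω` restricts to a self-equivalence of the stable category of the G-projective modules
(`restrictsToEquivalence_syzygyPow`), every Tate cohomology functor of `M` is representable.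
Representable functors are projective in `mod A`, because the epimorphisms of `mod A` are objectwise
surjective (`RightMod.surj_of_epi`).

*From finite generation to an approximation.* By the Yoneda lemma a surjection from `Hom(-, X)` onto
the `i`-th Tate cohomology functor is a map `α : Ωⁱ X ⟶ M` in the stable category. As `Ωⁱ` is full
and essentially surjective on stable G-projective modules, every map `Y ⟶ M` with `Y` G-projective
factors through `α` up to a map that factors through a free module. Adding the free cover of `M`
to `Ωⁱ X` gives a right approximation (`rap_of_finitelyGenerated_tateExt`).
-/

noncomputable section

/-! ### Idempotents over a Henselian local ring -/

section Henselian

open Polynomial IsLocalRing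

/-- Over a Henselian local ring `R`, an étale `R`-algebra has a section through every prime that
lies over the maximal ideal and has trivial residue field extension: locally the algebra is standard
étale, hence the section amounts to a lift of a simple root. -/
theorem exists_section_of_etale {R : Type u} [CommRing R] [HenselianLocalRing R]
    {R' : Type v} [CommRing R'] [Algebra R R'] [Algebra.Etale R R']
    (Q : Ideal R') [Q.IsPrime] [Q.LiesOver (maximalIdeal R)]
    (hQ : Function.Surjective (algebraMap R Q.ResidueField)) :
    ∃ σ : R' →ₐ[R] R, ∀ r, r ∉ Q → IsUnit (σ r) := by
  obtain ⟨f, hfQ, hf⟩ := Algebra.IsEtaleAt.exists_isStandardEtale (R := R) Q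
  obtain ⟨P⟩ := hf.nonempty_standardEtalePresentation
  have hfu : ∀ y : Submonoid.powers f, IsUnit (algebraMap R' Q.ResidueField y) := by
    rintro ⟨_, n, rfl⟩
    rw [map_pow]
    refine IsUnit.pow _ (isUnit_iff_ne_zero.2 fun h => hfQ ?_)
    exact Ideal.algebraMap_residueField_eq_zero.1 h
  -- `ρ` is the residue map at `Q`; the section below is built so that it induces `ρ` again.
  let ρ : Localization.Away f →ₐ[R] Q.ResidueField :=
    IsLocalization.liftAlgHom (M := Submonoid.powers f)
      (f := IsScalarTower.toAlgHom R R' Q.ResidueField) hfu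
  have hmem : ∀ a : R, algebraMap R Q.ResidueField a = 0 ↔ a ∈ maximalIdeal R := fun a => by
    rw [IsScalarTower.algebraMap_apply R R' Q.ResidueField, Ideal.algebraMap_residueField_eq_zero,
      Q.over_def (maximalIdeal R), Ideal.mem_comap]
  have hunit : ∀ a : R, algebraMap R Q.ResidueField a ≠ 0 ↔ IsUnit a := fun a => by
    rw [Ne, hmem, mem_maximalIdeal, mem_nonunits_iff, not_not]
  obtain ⟨a₀, ha₀⟩ := hQ (ρ P.x)
  have hx : P.HasMap (ρ P.x) := P.hasMap.map ρ
  have hae : ∀ (p : R[X]) (a : R), algebraMap R Q.ResidueField a = ρ P.x →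
      algebraMap R Q.ResidueField (p.eval a) = aeval (ρ P.x) p := fun p a ha => by
    rw [← ha, aeval_algebraMap_apply, coe_aeval_eq_eval]
  obtain ⟨a, ha, haa⟩ := HenselianLocalRing.is_henselian P.f P.monic_f a₀
    ((hmem _).1 (by rw [hae _ _ ha₀, hx.1]))
    ((hunit _).1 (by rw [hae _ _ ha₀]; exact hx.isUnit_derivative_f.ne_zero))
  have ha' : algebraMap R Q.ResidueField a = ρ P.x := by
    rw [← ha₀, ← sub_eq_zero, ← map_sub, hmem]
    exact haa
  have hmap : P.HasMap a := by
    refine ⟨by rw [coe_aeval_eq_eval]; exact ha, ?_⟩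
    rw [coe_aeval_eq_eval, ← hunit, hae _ _ ha']
    exact hx.2.ne_zero
  let τ : Localization.Away f →ₐ[R] R := (P.P.lift a hmap).comp P.equivRing.toAlgHom
  have hτ : (Algebra.ofId R Q.ResidueField).comp τ = ρ := by
    refine P.hom_ext ?_
    simp [τ, Algebra.ofId_apply, ha']
  refine ⟨τ.comp (IsScalarTower.toAlgHom R R' _), fun r hr => ?_⟩
  rw [← hunit]
  have h1 := AlgHom.congr_fun hτ (algebraMap R' _ r)
  change algebraMap R Q.ResidueField (τ (algebraMap R' _ r)) ≠ 0
  change algebraMap R Q.ResidueField (τ (algebraMap R' _ r)) = ρ (algebraMap R' _ r) at h1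
  rw [h1]
  have h2 : ρ (algebraMap R' _ r) = algebraMap R' Q.ResidueField r :=
    IsLocalization.lift_eq (M := Submonoid.powers f) hfu r
  rw [h2]
  exact fun h => hr (Ideal.algebraMap_residueField_eq_zero.1 h)

/-- The factorization of the reduction of a monic polynomial into a power of `X` and a polynomial
without the root `0` lifts to a Henselian local ring. -/
theorem exists_isCoprime_mul_eq_of_monic {R : Type u} [CommRing R] [HenselianLocalRing R]
    (p : R[X]) (hp : p.Monic) :
    ∃ f g : R[X], p = f * g ∧ IsCoprime f g ∧ IsUnit (f.eval 1) ∧ IsUnit (g.eval 0) := by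
  let k := (maximalIdeal R).ResidueField
  obtain ⟨q, hq, hq'⟩ := exists_eq_pow_rootMultiplicity_mul_and_not_dvd
    (p.map (algebraMap R k)) (hp.map _).ne_zero 0
  rw [C_0, sub_zero] at hq hq'
  set m := rootMultiplicity 0 (p.map (algebraMap R k))
  have hqm : q.Monic := by
    have h := congr(leadingCoeff $hq)
    rw [(hp.map _).leadingCoeff, leadingCoeff_monic_mul (monic_X.pow m)] at h
    exact h.symm
  have hcop : IsCoprime (X ^ m) q :=
    IsCoprime.pow_left ((prime_X (R := k)).irreducible.coprime_iff_not_dvd.2 hq')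
  obtain ⟨R', _, _, _, Q, _, _, f, g, hbij, -, -, hfg, hc, hf, hg⟩ :=
    Algebra.exists_etale_bijective_residueFieldMap_and_map_eq_mul_and_isCoprime (maximalIdeal R) p
      (X ^ m) q hp (monic_X.pow _) hqm hq hcop
  have hsurj : Function.Surjective (algebraMap R Q.ResidueField) := by
    have h1 : Function.Surjective (algebraMap R k) :=
      Ideal.algebraMap_residueField_surjective _
    intro y
    obtain ⟨z, rfl⟩ := hbij.2 y
    obtain ⟨r, rfl⟩ := h1 z
    exact ⟨r, (AlgHom.commutes _ r).symm⟩
  obtain ⟨σ, hσ⟩ := exists_section_of_etale Q hsurj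
  refine ⟨f.map σ.toRingHom, g.map σ.toRingHom, ?_, hc.map (mapRingHom σ.toRingHom), ?_, ?_⟩
  · rw [← Polynomial.map_mul, ← hfg, Polynomial.map_map]
    have : σ.toRingHom.comp (algebraMap R R') = RingHom.id R := σ.comp_algebraMap
    rw [this, Polynomial.map_id]
  · rw [← map_one σ.toRingHom, eval_map_apply]
    refine hσ _ fun h => ?_
    rw [← Ideal.algebraMap_residueField_eq_zero, ← eval_map_apply, ← hf] at h
    simp at h
  · rw [← map_zero σ.toRingHom, eval_map_apply]
    refine hσ _ fun h => hq' ?_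
    rw [← Ideal.algebraMap_residueField_eq_zero, ← eval_map_apply, ← hg, map_zero,
      ← map_zero (Ideal.ResidueField.mapₐ (maximalIdeal R) Q (Algebra.ofId _ _)
        (Ideal.over_def Q (maximalIdeal R))).toRingHom, eval_map_apply] at h
    rw [X_dvd_iff, coeff_zero_eq_eval_zero]
    exact hbij.1 h

/-- Over a Henselian local ring, an integral element `x` of an algebra admits an idempotent `e` such
that `x` is invertible on the part cut out by `e` and `1 - x` is invertible on the part cut out by
`1 - e`. -/
theorem exists_isIdempotentElem_of_isIntegral {R : Type u} [CommRing R] [HenselianLocalRing R]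
    {A : Type v} [Ring A] [Algebra R A] {x : A} (hx : IsIntegral R x) :
    ∃ e s t : A, IsIdempotentElem e ∧ 1 - e = (1 - x) * s ∧ e = x * t := by
  obtain ⟨p, hp, hpx⟩ := hx
  obtain ⟨f, g, rfl, ⟨a, b, hab⟩, hf, hg⟩ := exists_isCoprime_mul_eq_of_monic p hp
  have hpx' : aeval x (f * g) = 0 := hpx
  have he : 1 - aeval x (a * f) = aeval x (b * g) := by
    rw [← map_one (aeval (R := R) x), ← hab, map_add, add_sub_cancel_left]
  -- On the part cut out by `1 - e` the polynomial `f` vanishes at `x`, so that `f(1)`, a unit, is a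
  -- multiple of `1 - x`; on the part cut out by `e` the same holds for `g`, `g(0)` and `x`.
  obtain ⟨u, hu⟩ := X_sub_C_dvd_sub_C_eval (a := 1) (p := f)
  obtain ⟨v, hv⟩ := X_sub_C_dvd_sub_C_eval (a := 0) (p := g)
  obtain ⟨c, hc⟩ := hf
  obtain ⟨d, hd⟩ := hg
  have hcf : C (↑c⁻¹ : R) * C (f.eval 1) = 1 := by
    rw [← C_mul, ← hc, Units.inv_mul, C_1]
  have hdg : C (↑d⁻¹ : R) * C (g.eval 0) = 1 := by
    rw [← C_mul, ← hd, Units.inv_mul, C_1]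
  have hab' : ∀ q : R[X], aeval x (q * (f * g)) = 0 := fun q => by rw [map_mul, hpx', mul_zero]
  refine ⟨aeval x (a * f), aeval x (C (↑c⁻¹ : R) * u * (b * g)),
    aeval x (- C (↑d⁻¹ : R) * v * (a * f)), ?_, ?_, ?_⟩
  · have h := hab' (a * b)
    have h2 : a * b * (f * g) = (a * f) * (b * g) := by ring
    rw [h2, map_mul, ← he, mul_sub, mul_one, sub_eq_zero] at h
    exact h.symm
  · have h2 : b * g = (1 - X) * (C (↑c⁻¹ : R) * u * (b * g)) + C (↑c⁻¹ : R) * b * (f * g) := by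
      rw [C_1] at hu
      linear_combination (-(b * g)) * hcf - C (↑c⁻¹ : R) * b * g * hu
    rw [he]
    conv_lhs => rw [h2]
    rw [map_add, hab', add_zero, map_mul, map_sub, map_one, aeval_X]
  · have h2 : a * f = X * (- C (↑d⁻¹ : R) * v * (a * f)) + C (↑d⁻¹ : R) * a * (f * g) := by
      rw [C_0, sub_zero] at hv
      linear_combination (-(a * f)) * hdg - C (↑d⁻¹ : R) * a * f * hv
    conv_lhs => rw [h2]
    rw [map_add, hab', add_zero, map_mul, aeval_X]

end Henselian

/-! ### Right minimal direct summands -/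

section Minimal

/-- A linear map out of a finitely generated module over a Henselian local ring becomes right
minimal on a suitable direct summand `range e` that still carries the whole map. Among the
idempotents `e` with `φ ∘ e = φ` one takes one with a maximal complement `range (1 - e)`. -/
theorem exists_isIdempotentElem_rightMinimal {R : Type u} [CommRing R] [IsNoetherianRing R]
    [HenselianLocalRing R] {X : Type v} {M : Type w} [AddCommGroup X] [Module R X]
    [Module.Finite R X] [AddCommGroup M] [Module R M] (φ : X →ₗ[R] M) :
    ∃ e : Module.End R X, IsIdempotentElem e ∧ φ ∘ₗ e = φ ∧
      ∀ f : Module.End R (LinearMap.range e),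
        (∀ y, φ (f y : LinearMap.range e) = φ y) → Function.Bijective f := by
  let S : Set (Submodule R X) :=
    {N | ∃ e : Module.End R X, IsIdempotentElem e ∧ φ ∘ₗ e = φ ∧ LinearMap.range (1 - e) = N}
  have hS : S.Nonempty := ⟨_, 1, IsIdempotentElem.one, rfl, rfl⟩
  obtain ⟨_, ⟨e, he, hφe, rfl⟩, hmax⟩ := (wellFounded_gt (α := Submodule R X)).has_min S hS
  have hee : ∀ y : LinearMap.range e, e y = y := by
    rintro ⟨_, y, rfl⟩
    exact LinearMap.congr_fun he y
  refine ⟨e, he, hφe, fun f hf => ?_⟩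
  -- `φ` kills the part of `range e` on which `1 - f` is invertible, so it can be moved to the
  -- complement; maximality then forces `e₁ = 1`, and `f` is surjective.
  obtain ⟨e₁, s, t, he₁, hs, ht⟩ := exists_isIdempotentElem_of_isIntegral
    (R := R) (x := f) (Algebra.IsIntegral.isIntegral f)
  have hφe₁ : ∀ y, φ (e₁ y : LinearMap.range e) = φ y := fun y => by
    have h1 : y - e₁ y = s y - f (s y) := LinearMap.congr_fun hs y
    have h2 : φ ((y - e₁ y : LinearMap.range e) : X) = 0 := by
      rw [h1, Submodule.coe_sub, map_sub, hf, sub_self]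
    rw [Submodule.coe_sub, map_sub, sub_eq_zero] at h2
    exact h2.symm
  let e' : Module.End R X := (LinearMap.range e).subtype ∘ₗ e₁ ∘ₗ e.rangeRestrict
  have he'v : ∀ x, e' x = (e₁ (e.rangeRestrict x) : LinearMap.range e) := fun x => rfl
  have hr : ∀ y : LinearMap.range e, e.rangeRestrict (y : X) = y := fun y => Subtype.ext (hee y)
  have he' : IsIdempotentElem e' := by
    refine LinearMap.ext fun x => ?_
    change e' (e' x) = e' x
    rw [he'v, he'v x, hr]
    exact congrArg _ (LinearMap.congr_fun he₁ _)
  have hφe' : φ ∘ₗ e' = φ := by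
    refine LinearMap.ext fun x => ?_
    change φ (e' x) = φ x
    rw [he'v, hφe₁]
    exact LinearMap.congr_fun hφe x
  have hle : LinearMap.range (1 - e) ≤ LinearMap.range (1 - e') := by
    rintro _ ⟨x, rfl⟩
    refine ⟨(1 - e) x, ?_⟩
    have h1 : e.rangeRestrict ((1 - e) x) = 0 := Subtype.ext (by
      change e (x - e x) = 0
      rw [map_sub, sub_eq_zero]
      exact (LinearMap.congr_fun he x).symm)
    change (1 - e) x - e' ((1 - e) x) = _
    rw [he'v, h1, map_zero, Submodule.coe_zero, sub_zero]
  have heq : LinearMap.range (1 - e) = LinearMap.range (1 - e') :=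
    eq_of_le_of_not_lt hle (hmax _ ⟨e', he', hφe', rfl⟩)
  have hone : ∀ y, e₁ y = y := fun y => by
    have h1 : (1 - e') (y : X) ∈ LinearMap.range (1 - e) := heq ▸ LinearMap.mem_range_self _ _
    obtain ⟨x, hx⟩ := h1
    have h2 : (1 - e') (y : X) = ((y - e₁ y : LinearMap.range e) : X) := by
      change (y : X) - e' y = _
      rw [he'v, hr, Submodule.coe_sub]
    rw [h2] at hx
    have h3 := hee (y - e₁ y)
    rw [← hx] at h3
    have h4 : e ((1 - e) x) = 0 := by
      change e (x - e x) = 0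
      rw [map_sub, sub_eq_zero]
      exact (LinearMap.congr_fun he x).symm
    rw [h4, hx] at h3
    exact (sub_eq_zero.1 (Subtype.ext h3.symm)).symm
  have hsurj : Function.Surjective f := fun y =>
    ⟨t y, (LinearMap.congr_fun ht y).symm.trans (hone y)⟩
  exact ⟨IsNoetherian.injective_of_surjective_endomorphism f hsurj, hsurj⟩

end Minimal

/-! ### Closure properties of G-projective modules -/

section ExtVanishing

open Abelian

variable {R : Type u} [CommRing R]

variable (R) in
/-- The vanishing of `Extⁱ(A, R)` for all `i > 0`. -/
def ExtVanishes (A : Type u) [AddCommGroup A] [Module R A] : Prop :=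
  ∀ i : ℕ, 0 < i → Subsingleton (Ext (ModuleCat.of R A) (ModuleCat.of R R) i)

variable (R) in
/-- G-projectivity as a property of unbundled modules; on finitely generated modules it is `GProj`
by definition. -/
def IsGProj (A : Type u) [AddCommGroup A] [Module R A] : Prop :=
  Function.Bijective (Module.Dual.eval R A) ∧ ExtVanishes R A ∧ ExtVanishes R (Module.Dual R A)

lemma ExtVanishes.of_projective (A : Type u) [AddCommGroup A] [Module R A] [Module.Projective R A] :
    ExtVanishes R A := fun i hi => by
  obtain ⟨n, rfl⟩ := Nat.exists_eq_succ_of_ne_zero hi.ne'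
  have : Projective (ModuleCat.of R A) := (IsProjective.iff_projective _).1 inferInstance
  exact Ext.subsingleton_of_projective _ _ n

lemma IsGProj.of_free (A : Type u) [AddCommGroup A] [Module R A] [Module.Free R A]
    [Module.Finite R A] : IsGProj R A :=
  ⟨Module.bijective_dual_eval R A, .of_projective A, .of_projective _⟩

section Retract

variable {A B : Type u} [AddCommGroup A] [Module R A] [AddCommGroup B] [Module R B]

lemma ExtVanishes.of_retract (h : ExtVanishes R B) (i : A →ₗ[R] B) (r : B →ₗ[R] A)
    (hir : r ∘ₗ i = LinearMap.id) : ExtVanishes R A := fun n hn => by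
  have := h n hn
  have hz : ∀ x : Ext (ModuleCat.of R A) (ModuleCat.of R R) n, x = 0 := fun x => by
    have h1 : ModuleCat.ofHom i ≫ ModuleCat.ofHom r = 𝟙 (ModuleCat.of R A) := by
      rw [← ModuleCat.ofHom_comp, hir]; rfl
    rw [← Ext.mk₀_id_comp x, ← h1, ← Ext.mk₀_comp_mk₀_assoc,
      Subsingleton.elim ((Ext.mk₀ (ModuleCat.ofHom r)).comp x (zero_add n)) 0, Ext.comp_zero]
  exact ⟨fun x y => (hz x).trans (hz y).symm⟩

lemma IsGProj.of_retract (h : IsGProj R B) (i : A →ₗ[R] B) (r : B →ₗ[R] A)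
    (hir : r ∘ₗ i = LinearMap.id) : IsGProj R A := by
  have hd : i.dualMap ∘ₗ r.dualMap = LinearMap.id := by
    rw [LinearMap.dualMap_comp_dualMap, hir, LinearMap.dualMap_id]
  have hri : ∀ a, r (i a) = a := LinearMap.congr_fun hir
  have hdd : ∀ x, r.dualMap.dualMap (i.dualMap.dualMap x) = x := fun x => by
    change (r.dualMap.dualMap ∘ₗ i.dualMap.dualMap) x = x
    rw [LinearMap.dualMap_comp_dualMap, hd, LinearMap.dualMap_id, LinearMap.id_apply]
  refine ⟨⟨fun a b hab => ?_, fun x => ?_⟩, h.2.1.of_retract i r hir,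
    h.2.2.of_retract r.dualMap i.dualMap hd⟩
  · rw [← hri a, ← hri b]
    refine congrArg r (h.1.1 ?_)
    have := congrArg i.dualMap.dualMap hab
    exact this
  · obtain ⟨y, hy⟩ := h.1.2 (i.dualMap.dualMap x)
    refine ⟨r y, ?_⟩
    rw [← hdd x, ← hy]
    rfl

end Retract

section ShortExact

variable {A B C : Type u} [AddCommGroup A] [Module R A] [AddCommGroup B] [Module R B]
  [AddCommGroup C] [Module R C] {f : A →ₗ[R] B} {g : B →ₗ[R] C}

lemma ModuleCat.shortExact_of_exact (hf : Function.Injective f) (hfg : Function.Exact f g)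
    (hg : Function.Surjective g) :
    (ShortComplex.mk (ModuleCat.ofHom f) (ModuleCat.ofHom g) (by
      rw [← ModuleCat.ofHom_comp, hfg.linearMap_comp_eq_zero]; rfl)).ShortExact where
  exact := (ShortComplex.ShortExact.moduleCat_exact_iff_function_exact _).mpr hfg
  mono_f := (ModuleCat.mono_iff_injective _).2 hf
  epi_g := (ModuleCat.epi_iff_surjective _).2 hg

lemma ExtVanishes.middle (hf : Function.Injective f) (hfg : Function.Exact f g)
    (hg : Function.Surjective g) (hA : ExtVanishes R A) (hC : ExtVanishes R C) :
    ExtVanishes R B := fun n hn => by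
  have := hA n hn
  have := hC n hn
  have hz : ∀ x : Ext (ModuleCat.of R B) (ModuleCat.of R R) n, x = 0 := fun x => by
    obtain ⟨y, rfl⟩ := Ext.contravariant_sequence_exact₂
      (ModuleCat.shortExact_of_exact hf hfg hg) _ x
      (Subsingleton.elim (α := Ext (ModuleCat.of R A) (ModuleCat.of R R) n) _ _)
    rw [Subsingleton.elim (α := Ext (ModuleCat.of R C) (ModuleCat.of R R) n) y 0, Ext.comp_zero]
  exact ⟨fun x y => (hz x).trans (hz y).symm⟩

lemma ExtVanishes.left (hf : Function.Injective f) (hfg : Function.Exact f g)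
    (hg : Function.Surjective g) (hB : ExtVanishes R B) (hC : ExtVanishes R C) :
    ExtVanishes R A := fun n hn => by
  have := hB n hn
  have := hC (1 + n) (by omega)
  have hz : ∀ x : Ext (ModuleCat.of R A) (ModuleCat.of R R) n, x = 0 := fun x => by
    obtain ⟨y, rfl⟩ := Ext.contravariant_sequence_exact₁
      (ModuleCat.shortExact_of_exact hf hfg hg) _ x rfl
      (Subsingleton.elim (α := Ext (ModuleCat.of R C) (ModuleCat.of R R) (1 + n)) _ _)
    rw [Subsingleton.elim (α := Ext (ModuleCat.of R B) (ModuleCat.of R R) n) y 0, Ext.comp_zero]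
  exact ⟨fun x y => (hz x).trans (hz y).symm⟩

lemma dualMap_surjective_of_extVanishes (hf : Function.Injective f) (hfg : Function.Exact f g)
    (hg : Function.Surjective g) (hC : ExtVanishes R C) : Function.Surjective f.dualMap := by
  intro a
  have := hC (1 + 0) (by omega)
  obtain ⟨y, hy⟩ := Ext.contravariant_sequence_exact₁ (ModuleCat.shortExact_of_exact hf hfg hg) _
    (Ext.mk₀ (ModuleCat.ofHom a)) rfl
    (Subsingleton.elim (α := Ext (ModuleCat.of R C) (ModuleCat.of R R) (1 + 0)) _ _)
  obtain ⟨b, rfl⟩ := (Ext.mk₀_bijective _ _).2 y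
  refine ⟨b.hom, ?_⟩
  rw [Ext.mk₀_comp_mk₀] at hy
  exact congrArg ModuleCat.Hom.hom ((Ext.mk₀_bijective _ _).1 hy)

lemma ExtVanishes.right (hf : Function.Injective f) (hfg : Function.Exact f g)
    (hg : Function.Surjective g) (hA : ExtVanishes R A) (hB : ExtVanishes R B)
    (hs : Function.Surjective f.dualMap) : ExtVanishes R C := fun n hn => by
  obtain ⟨n, rfl⟩ : ∃ m, n = 1 + m := ⟨n - 1, by omega⟩
  have := hB (1 + n) hn
  have hS := ModuleCat.shortExact_of_exact hf hfg hg
  have hz : ∀ x : Ext (ModuleCat.of R C) (ModuleCat.of R R) (1 + n), x = 0 := fun x => by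
    obtain ⟨y, rfl⟩ := Ext.contravariant_sequence_exact₃ hS _ x
      (Subsingleton.elim (α := Ext (ModuleCat.of R B) (ModuleCat.of R R) (1 + n)) _ _) rfl
    rcases Nat.eq_zero_or_pos n with rfl | hn'
    · obtain ⟨a, rfl⟩ := (Ext.mk₀_bijective _ _).2 y
      obtain ⟨b, hb⟩ := hs a.hom
      have : a = ModuleCat.ofHom f ≫ ModuleCat.ofHom b := ModuleCat.hom_ext hb.symm
      rw [this, ← Ext.mk₀_comp_mk₀]
      exact hS.extClass_comp_assoc _
    · have := hA n hn'
      rw [Subsingleton.elim (α := Ext (ModuleCat.of R A) (ModuleCat.of R R) n) y 0, Ext.comp_zero]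
  exact ⟨fun x y => (hz x).trans (hz y).symm⟩

lemma dualMap_exact (hfg : Function.Exact f g) (hg : Function.Surjective g) :
    Function.Exact g.dualMap f.dualMap :=
  LinearMap.exact_lcomp_of_exact_of_surjective R hfg hg

/-- G-projective modules are closed under extensions. -/
theorem IsGProj.middle (hf : Function.Injective f) (hfg : Function.Exact f g)
    (hg : Function.Surjective g) (hA : IsGProj R A) (hC : IsGProj R C) : IsGProj R B := by
  have hs := dualMap_surjective_of_extVanishes hf hfg hg hC.2.1
  have hi := LinearMap.dualMap_injective_of_surjective hg
  have he := dualMap_exact hfg hg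
  have hss := dualMap_surjective_of_extVanishes hi he hs hA.2.2
  have hii := LinearMap.dualMap_injective_of_surjective hs
  have hee := dualMap_exact he hs
  refine ⟨⟨?_, fun y => ?_⟩, .middle hf hfg hg hA.2.1 hC.2.1, .middle hi he hs hC.2.2 hA.2.2⟩
  · refine (injective_iff_map_eq_zero _).2 fun b hb => ?_
    have h1 : Module.Dual.eval R C (g b) = 0 := congrArg g.dualMap.dualMap hb
    obtain ⟨a, rfl⟩ := (hfg b).1 (hC.1.1 (h1.trans (map_zero _).symm))
    have h2 : f.dualMap.dualMap (Module.Dual.eval R A a) = 0 := hb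
    rw [hA.1.1 ((hii (h2.trans (map_zero _).symm)).trans (map_zero _).symm), map_zero]
  · obtain ⟨c, hc⟩ := hC.1.2 (g.dualMap.dualMap y)
    obtain ⟨b, rfl⟩ := hg c
    have h1 : g.dualMap.dualMap (y - Module.Dual.eval R B b) = 0 := by
      rw [map_sub, ← hc]
      exact sub_self _
    obtain ⟨z, hz⟩ := (hee _).1 h1
    obtain ⟨a, rfl⟩ := hA.1.2 z
    refine ⟨f a + b, ?_⟩
    rw [map_add, ← eq_sub_iff_add_eq, ← hz]
    rfl

/-- G-projective modules are closed under kernels of surjections. -/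
theorem IsGProj.left (hf : Function.Injective f) (hfg : Function.Exact f g)
    (hg : Function.Surjective g) (hB : IsGProj R B) (hC : IsGProj R C) : IsGProj R A := by
  have hs := dualMap_surjective_of_extVanishes hf hfg hg hC.2.1
  have hi := LinearMap.dualMap_injective_of_surjective hg
  have he := dualMap_exact hfg hg
  have hii := LinearMap.dualMap_injective_of_surjective hs
  have hss : Function.Surjective g.dualMap.dualMap := fun y => by
    obtain ⟨c, rfl⟩ := hC.1.2 y
    obtain ⟨b, rfl⟩ := hg c
    exact ⟨Module.Dual.eval R B b, rfl⟩
  refine ⟨⟨fun a b hab => hf (hB.1.1 (congrArg f.dualMap.dualMap hab)), fun y => ?_⟩,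
    .left hf hfg hg hB.2.1 hC.2.1, .right hi he hs hC.2.2 hB.2.2 hss⟩
  obtain ⟨b, hb⟩ := hB.1.2 (f.dualMap.dualMap y)
  have h1 : Module.Dual.eval R C (g b) = 0 := by
    have h2 := (dualMap_exact he hs).apply_apply_eq_zero y
    rw [← hb] at h2
    exact h2
  obtain ⟨a, rfl⟩ := (hfg b).1 (hC.1.1 (h1.trans (map_zero _).symm))
  exact ⟨a, hii hb⟩

/-- The cokernel of an injection between G-projective modules is G-projective as soon as every
linear form extends along the injection. -/
theorem IsGProj.right (hf : Function.Injective f) (hfg : Function.Exact f g)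
    (hg : Function.Surjective g) (hA : IsGProj R A) (hB : IsGProj R B)
    (hs : Function.Surjective f.dualMap) : IsGProj R C := by
  have hi := LinearMap.dualMap_injective_of_surjective hg
  have he := dualMap_exact hfg hg
  have hss := dualMap_surjective_of_extVanishes hi he hs hA.2.2
  refine ⟨⟨?_, fun y => ?_⟩, .right hf hfg hg hA.2.1 hB.2.1 hs, .left hi he hs hB.2.2 hA.2.2⟩
  · refine (injective_iff_map_eq_zero _).2 fun c hc => ?_
    obtain ⟨b, rfl⟩ := hg c
    obtain ⟨z, hz⟩ := (dualMap_exact he hs (Module.Dual.eval R B b)).1 hc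
    obtain ⟨a, rfl⟩ := hA.1.2 z
    exact (hfg b).2 ⟨a, hB.1.1 hz⟩
  · obtain ⟨x, rfl⟩ := hss y
    obtain ⟨b, rfl⟩ := hB.1.2 x
    exact ⟨g b, rfl⟩

end ShortExact

lemma IsGProj.prod {A B : Type u} [AddCommGroup A] [Module R A] [AddCommGroup B] [Module R B]
    (hA : IsGProj R A) (hB : IsGProj R B) : IsGProj R (A × B) :=
  .middle (f := LinearMap.inl R A B) (g := LinearMap.snd R A B) LinearMap.inl_injective
    Function.Exact.inl_snd LinearMap.snd_surjective hA hB

end ExtVanishing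

/-! ### Syzygies and cosyzygies in the stable category -/

section FreeConflation

variable {R : Type u} [CommRing R]

/-- A short exact sequence `0 ⟶ A ⟶ F ⟶ Y ⟶ 0` with `F` free that stays exact under `Hom(-, R)`:
it exhibits `A` as a syzygy of `Y` and `Y` as a cosyzygy of `A`. -/
structure FreeConflation {A F Y : FGModuleCat.{u} R} (i : A ⟶ F) (p : F ⟶ Y) : Prop where
  free : freeMod R F
  injective : Function.Injective i.hom.hom
  exact : Function.Exact i.hom.hom p.hom.hom
  surjective : Function.Surjective p.hom.hom
  dualMap_surjective : Function.Surjective i.hom.hom.dualMap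

/-- The existence of a morphism from the sequence `(i, p)` to the sequence `(i', p')` with
prescribed outer components `a` and `y`. -/
def IsConflationMap {A F Y A' F' Y' : FGModuleCat.{u} R} (i : A ⟶ F) (p : F ⟶ Y) (i' : A' ⟶ F')
    (p' : F' ⟶ Y') (a : A ⟶ A') (y : Y ⟶ Y') : Prop :=
  ∃ u : F ⟶ F', u ≫ p' = p ≫ y ∧ a ≫ i' = i ≫ u

lemma FGModuleCat.congr_hom {X Y : FGModuleCat.{u} R} {f g : X ⟶ Y} (h : f = g) (x : X) :
    f.hom.hom x = g.hom.hom x := by rw [h]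

namespace FreeConflation

variable {A F Y A' F' Y' : FGModuleCat.{u} R} {i : A ⟶ F} {p : F ⟶ Y} {i' : A' ⟶ F'}
  {p' : F' ⟶ Y'}

lemma zero (h : FreeConflation i p) : i ≫ p = 0 := by
  ext x
  exact h.exact.apply_apply_eq_zero x

lemma cancel_i (h : FreeConflation i p) {Z : FGModuleCat.{u} R} {a b : Z ⟶ A}
    (hab : a ≫ i = b ≫ i) : a = b := by
  ext x
  exact h.injective (FGModuleCat.congr_hom hab x)

lemma cancel_p (h : FreeConflation i p) {Z : FGModuleCat.{u} R} {a b : Y ⟶ Z}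
    (hab : p ≫ a = p ≫ b) : a = b := by
  ext x
  obtain ⟨x, rfl⟩ := h.surjective x
  exact FGModuleCat.congr_hom hab x

lemma exists_lift (h : FreeConflation i p) {Z : FGModuleCat.{u} R} (a : Z ⟶ F)
    (ha : a ≫ p = 0) : ∃ b : Z ⟶ A, b ≫ i = a := by
  let e := LinearEquiv.ofInjective i.hom.hom h.injective
  refine ⟨FGModuleCat.ofHom (e.symm.toLinearMap ∘ₗ a.hom.hom.codRestrict _ fun x =>
    (h.exact _).1 (FGModuleCat.congr_hom ha x)), ?_⟩
  ext x
  exact congrArg Subtype.val (e.apply_symm_apply _)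

lemma exists_desc (h : FreeConflation i p) {Z : FGModuleCat.{u} R} (a : F ⟶ Z)
    (ha : i ≫ a = 0) : ∃ b : Y ⟶ Z, p ≫ b = a := by
  have hk : LinearMap.ker p.hom.hom ≤ LinearMap.ker a.hom.hom := fun x hx => by
    obtain ⟨x, rfl⟩ := (h.exact x).1 hx
    exact FGModuleCat.congr_hom ha x
  let e := p.hom.hom.quotKerEquivOfSurjective h.surjective
  refine ⟨FGModuleCat.ofHom ((LinearMap.ker p.hom.hom).liftQ a.hom.hom hk ∘ₗ
    e.symm.toLinearMap), ?_⟩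
  ext x
  change (LinearMap.ker p.hom.hom).liftQ a.hom.hom hk (e.symm (p.hom.hom x)) = _
  have : p.hom.hom x = e (Submodule.Quotient.mk x) := rfl
  rw [this, e.symm_apply_apply]
  rfl

lemma exists_lift_free (h : FreeConflation i p) {G : FGModuleCat.{u} R} (hG : freeMod R G)
    (a : G ⟶ Y) : ∃ b : G ⟶ F, b ≫ p = a := by
  have : Module.Free R G := hG
  obtain ⟨b, hb⟩ := Module.projective_lifting_property p.hom.hom a.hom.hom h.surjective
  exact ⟨FGModuleCat.ofHom b, by ext x; exact LinearMap.congr_fun hb x⟩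

lemma exists_extend_free (h : FreeConflation i p) {G : FGModuleCat.{u} R} (hG : freeMod R G)
    (a : A ⟶ G) : ∃ b : F ⟶ G, i ≫ b = a := by
  have : Module.Free R G := hG
  let β := Module.Free.chooseBasis R G
  choose c hc using fun j => h.dualMap_surjective ((β.coord j).comp a.hom.hom)
  refine ⟨FGModuleCat.ofHom (∑ j, (c j).smulRight (β j)), ?_⟩
  ext x
  change (∑ j, (c j).smulRight (β j)) (i.hom.hom x) = a.hom.hom x
  have h1 : ∀ j, c j (i.hom.hom x) = β.repr (a.hom.hom x) j := fun j => LinearMap.congr_fun (hc j) x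
  simp only [LinearMap.sum_apply, LinearMap.smulRight_apply, h1]
  exact β.sum_repr _

lemma exists_left (h' : FreeConflation i' p') (hF : freeMod R F) (hz : i ≫ p = 0) (y : Y ⟶ Y') :
    ∃ a, IsConflationMap i p i' p' a y := by
  obtain ⟨u, hu⟩ := h'.exists_lift_free hF (p ≫ y)
  obtain ⟨a, ha⟩ := h'.exists_lift (i ≫ u) (by
    rw [Category.assoc, hu, ← Category.assoc, hz, Limits.zero_comp])
  exact ⟨a, u, hu, ha⟩

lemma exists_right (h : FreeConflation i p) (h' : FreeConflation i' p') (a : A ⟶ A') :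
    ∃ y, IsConflationMap i p i' p' a y := by
  obtain ⟨u, hu⟩ := h.exists_extend_free h'.free (a ≫ i')
  obtain ⟨y, hy⟩ := h.exists_desc (u ≫ p') (by
    rw [← Category.assoc, hu, Category.assoc, h'.zero, Limits.comp_zero])
  exact ⟨y, u, hy.symm, hu.symm⟩

/-- A morphism of free conflations is stably trivial on the left if and only if it is stably
trivial on the right. -/
lemma factorsThroughFree_iff (h : FreeConflation i p) (h' : FreeConflation i' p')
    {a : A ⟶ A'} {y : Y ⟶ Y'} (hm : IsConflationMap i p i' p' a y) :
    FactorsThroughFree a ↔ FactorsThroughFree y := by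
  obtain ⟨u, hu, hu'⟩ := hm
  constructor
  · rintro ⟨G, hG, α, β, rfl⟩
    obtain ⟨α', rfl⟩ := h.exists_extend_free hG α
    obtain ⟨s, hs⟩ := h.exists_desc (u - α' ≫ β ≫ i') (by
      rw [Preadditive.comp_sub, ← hu', sub_eq_zero]
      simp only [Category.assoc])
    refine ⟨F', h'.free, s, p', h.cancel_p ?_⟩
    rw [← Category.assoc, hs, Preadditive.sub_comp, hu, Category.assoc, Category.assoc, h'.zero,
      Limits.comp_zero, Limits.comp_zero, sub_zero]
  · rintro ⟨G, hG, α, β, rfl⟩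
    obtain ⟨β', rfl⟩ := h'.exists_lift_free hG β
    obtain ⟨s, hs⟩ := h'.exists_lift (u - p ≫ α ≫ β') (by
      rw [Preadditive.sub_comp, hu, sub_eq_zero]
      simp only [Category.assoc])
    refine ⟨F, h.free, i, s, h'.cancel_i ?_⟩
    rw [Category.assoc, hs, Preadditive.comp_sub, hu', ← Category.assoc i p, h.zero,
      Limits.zero_comp, sub_zero]

end FreeConflation

section

variable {A F Y A' F' Y' A'' F'' Y'' : FGModuleCat.{u} R} {i : A ⟶ F} {p : F ⟶ Y} {i' : A' ⟶ F'}
  {p' : F' ⟶ Y'} {i'' : A'' ⟶ F''} {p'' : F'' ⟶ Y''}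

lemma IsConflationMap.id : IsConflationMap i p i p (𝟙 A) (𝟙 Y) := ⟨𝟙 F, by simp, by simp⟩

lemma IsConflationMap.comp {a : A ⟶ A'} {y : Y ⟶ Y'} {a' : A' ⟶ A''} {y' : Y' ⟶ Y''}
    (h : IsConflationMap i p i' p' a y) (h' : IsConflationMap i' p' i'' p'' a' y') :
    IsConflationMap i p i'' p'' (a ≫ a') (y ≫ y') := by
  obtain ⟨u, h1, h2⟩ := h
  obtain ⟨v, h3, h4⟩ := h'
  refine ⟨u ≫ v, ?_, ?_⟩
  · rw [Category.assoc, h3, ← Category.assoc, h1, Category.assoc]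
  · rw [Category.assoc, h4, ← Category.assoc, h2, Category.assoc]

lemma IsConflationMap.sub {a b : A ⟶ A'} {y z : Y ⟶ Y'}
    (h : IsConflationMap i p i' p' a y) (h' : IsConflationMap i p i' p' b z) :
    IsConflationMap i p i' p' (a - b) (y - z) := by
  obtain ⟨u, h1, h2⟩ := h
  obtain ⟨v, h3, h4⟩ := h'
  exact ⟨u - v, by simp [Preadditive.sub_comp, Preadditive.comp_sub, h1, h3],
    by simp [Preadditive.sub_comp, Preadditive.comp_sub, h2, h4]⟩

end

lemma toStable_map_eq_iff {X Y : FGModuleCat.{u} R} (f g : X ⟶ Y) :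
    (toStable R).map f = (toStable R).map g ↔ FactorsThroughFree (f - g) :=
  Quotient.functor_map_eq_iff (stableRel R) f g

/-- Two syzygies of the same module are stably isomorphic (Schanuel's lemma). -/
lemma FreeConflation.nonempty_iso_left {A F A' F' Y : FGModuleCat.{u} R} {i : A ⟶ F} {p : F ⟶ Y}
    {i' : A' ⟶ F'} {p' : F' ⟶ Y} (h : FreeConflation i p) (h' : FreeConflation i' p') :
    Nonempty ((toStable R).obj A ≅ (toStable R).obj A') := by
  obtain ⟨a, ha⟩ := h'.exists_left h.free h.zero (𝟙 Y)
  obtain ⟨b, hb⟩ := h.exists_left h'.free h'.zero (𝟙 Y)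
  refine ⟨⟨(toStable R).map a, (toStable R).map b, ?_, ?_⟩⟩
  · rw [← Functor.map_comp, ← CategoryTheory.Functor.map_id, toStable_map_eq_iff,
      h.factorsThroughFree_iff h ((ha.comp hb).sub .id)]
    simpa using FactorsThroughFree.zero
  · rw [← Functor.map_comp, ← CategoryTheory.Functor.map_id, toStable_map_eq_iff,
      h'.factorsThroughFree_iff h' ((hb.comp ha).sub .id)]
    simpa using FactorsThroughFree.zero

/-- Two cosyzygies of the same module are stably isomorphic. -/
lemma FreeConflation.nonempty_iso_right {A F F' Y Y' : FGModuleCat.{u} R} {i : A ⟶ F} {p : F ⟶ Y}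
    {i' : A ⟶ F'} {p' : F' ⟶ Y'} (h : FreeConflation i p) (h' : FreeConflation i' p') :
    Nonempty ((toStable R).obj Y ≅ (toStable R).obj Y') := by
  obtain ⟨y, hy⟩ := h.exists_right h' (𝟙 A)
  obtain ⟨z, hz⟩ := h'.exists_right h (𝟙 A)
  refine ⟨⟨(toStable R).map y, (toStable R).map z, ?_, ?_⟩⟩
  · rw [← Functor.map_comp, ← CategoryTheory.Functor.map_id, toStable_map_eq_iff,
      ← h.factorsThroughFree_iff h ((hy.comp hz).sub .id)]
    simpa using FactorsThroughFree.zero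
  · rw [← Functor.map_comp, ← CategoryTheory.Functor.map_id, toStable_map_eq_iff,
      ← h'.factorsThroughFree_iff h' ((hz.comp hy).sub .id)]
    simpa using FactorsThroughFree.zero

/-- A right approximation by a class of modules that contains `R` is surjective, because every
map `R → M` factors through it. -/
lemma IsRightApproximation.surjective {P : ObjectProperty (FGModuleCat.{u} R)}
    (hP : P (FGModuleCat.of R R)) {X M : FGModuleCat.{u} R} {φ : X ⟶ M}
    (h : IsRightApproximation P φ) : Function.Surjective φ.hom.hom := fun m => by
  obtain ⟨f, hf⟩ := h.2 hP (FGModuleCat.ofHom (LinearMap.toSpanSingleton R M m))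
  refine ⟨f.hom.hom (1 : R), (FGModuleCat.congr_hom hf (1 : R)).trans ?_⟩
  exact one_smul R m

lemma FreeConflation.isGProj_middle {A F Y : FGModuleCat.{u} R} {i : A ⟶ F} {p : F ⟶ Y}
    (h : FreeConflation i p) : IsGProj R F :=
  have : Module.Free R F := h.free
  .of_free F

end FreeConflation

section RestrictsToEquivalence

variable {R : Type u} [CommRing R]

/-- An endofunctor of the stable category that restricts to an equivalence of the stable category of
the G-projective modules with itself. -/
structure RestrictsToEquivalence (T : StableMod R ⥤ StableMod R) : Prop where
  gProj_obj : ∀ X : StableMod R, GProj R X.as → GProj R (T.obj X).as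
  map_bijective : ∀ X Y : StableMod R, GProj R X.as → GProj R Y.as →
    Function.Bijective (T.map : (X ⟶ Y) → _)
  exists_iso : ∀ Y : StableMod R, GProj R Y.as →
    ∃ X : StableMod R, GProj R X.as ∧ Nonempty (T.obj X ≅ Y)

lemma RestrictsToEquivalence.id : RestrictsToEquivalence (𝟭 (StableMod R)) where
  gProj_obj _ h := h
  map_bijective _ _ _ _ := Function.bijective_id
  exists_iso Y h := ⟨Y, h, ⟨Iso.refl _⟩⟩

lemma RestrictsToEquivalence.comp {S T : StableMod R ⥤ StableMod R}
    (hS : RestrictsToEquivalence S) (hT : RestrictsToEquivalence T) :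
    RestrictsToEquivalence (S ⋙ T) where
  gProj_obj X h := hT.gProj_obj _ (hS.gProj_obj X h)
  map_bijective X Y hX hY := (hT.map_bijective _ _ (hS.gProj_obj X hX) (hS.gProj_obj Y hY)).comp
    (hS.map_bijective X Y hX hY)
  exists_iso Y hY := by
    obtain ⟨Z, hZ, ⟨e⟩⟩ := hT.exists_iso Y hY
    obtain ⟨X, hX, ⟨e'⟩⟩ := hS.exists_iso Z hZ
    exact ⟨X, hX, ⟨T.mapIso e' ≪≫ e⟩⟩

lemma RestrictsToEquivalence.iterFunctor {T : StableMod R ⥤ StableMod R}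
    (hT : RestrictsToEquivalence T) (n : ℕ) : RestrictsToEquivalence (iterFunctor T n) := by
  induction n with
  | zero => exact .id
  | succ n ih => exact ih.comp hT

end RestrictsToEquivalence

section StableEquivalence

variable {R : Type u} [CommRing R] [IsNoetherianRing R] [IsLocalRing R]

lemma freeEnvelopeMap_dualMap_surjective (M : FGModuleCat.{u} R) :
    Function.Surjective (freeEnvelopeMap M).hom.hom.dualMap := fun a => by
  obtain ⟨f, hf⟩ := (freeEnvelopeMap_isLeftApproximation M).2
    (inferInstanceAs (Module.Free R R)) (FGModuleCat.ofHom a : M ⟶ FGModuleCat.of R R)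
  exact ⟨f.hom.hom, LinearMap.ext fun x => FGModuleCat.congr_hom hf x⟩

lemma syzygy_exact (M : FGModuleCat.{u} R) :
    Function.Exact (syzygyι M).hom.hom (freeCoverMap M).hom.hom := fun x =>
  ⟨fun hx => ⟨⟨x, hx⟩, rfl⟩, by rintro ⟨y, rfl⟩; exact y.2⟩

lemma cosyzygy_exact (M : FGModuleCat.{u} R) :
    Function.Exact (freeEnvelopeMap M).hom.hom (cosyzygyπ M).hom.hom := fun _ =>
  Submodule.Quotient.mk_eq_zero _

lemma freeConflation_syzygy {X : FGModuleCat.{u} R} (hX : GProj R X) :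
    FreeConflation (syzygyι X) (freeCoverMap X) where
  free := (freeCoverMap_isRightApproximation X).1
  injective := Subtype.val_injective
  exact := syzygy_exact X
  surjective := (freeCoverMap_isRightApproximation X).surjective
    (inferInstanceAs (Module.Free R R))
  dualMap_surjective := dualMap_surjective_of_extVanishes (f := (syzygyι X).hom.hom)
    (g := (freeCoverMap X).hom.hom) Subtype.val_injective (syzygy_exact X)
    ((freeCoverMap_isRightApproximation X).surjective (inferInstanceAs (Module.Free R R))) hX.2.1

lemma freeConflation_cosyzygy {X : FGModuleCat.{u} R} (hX : GProj R X) :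
    FreeConflation (freeEnvelopeMap X) (cosyzygyπ X) where
  free := (freeEnvelopeMap_isLeftApproximation X).1
  injective := by
    refine (injective_iff_map_eq_zero _).2 fun x hx => hX.1.1 ?_
    rw [map_zero]
    ext a
    obtain ⟨b, rfl⟩ := freeEnvelopeMap_dualMap_surjective X a
    exact (congrArg b hx).trans (map_zero b)
  exact := cosyzygy_exact X
  surjective := Submodule.mkQ_surjective _
  dualMap_surjective := freeEnvelopeMap_dualMap_surjective X

lemma GProj.syzygyObj {X : FGModuleCat.{u} R} (hX : GProj R X) : GProj R (syzygyObj X) :=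
  have h := freeConflation_syzygy hX
  IsGProj.left h.injective h.exact h.surjective h.isGProj_middle hX

lemma GProj.cosyzygyObj {X : FGModuleCat.{u} R} (hX : GProj R X) : GProj R (cosyzygyObj X) :=
  have h := freeConflation_cosyzygy hX
  IsGProj.right h.injective h.exact h.surjective hX h.isGProj_middle h.dualMap_surjective

lemma syzygy_map_eq {M N : FGModuleCat.{u} R} {f : M ⟶ N}
    {g : syzygyObj M ⟶ syzygyObj N} (h : IsSyzygyMap f g) :
    (syzygy R).map ((toStable R).map f) = (toStable R).map g :=
  (exists_isSyzygyMap f).choose_spec.toStable_map_eq h (by simpa using FactorsThroughFree.zero)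

lemma cosyzygy_map_eq {M N : FGModuleCat.{u} R} {f : M ⟶ N}
    {g : cosyzygyObj M ⟶ cosyzygyObj N} (h : IsCosyzygyMap f g) :
    (cosyzygy R).map ((toStable R).map f) = (toStable R).map g :=
  (exists_isCosyzygyMap f).choose_spec.toStable_map_eq h (by simpa using FactorsThroughFree.zero)

lemma isCosyzygyMap_iff {M N : FGModuleCat.{u} R} {f : M ⟶ N}
    {g : cosyzygyObj M ⟶ cosyzygyObj N} : IsCosyzygyMap f g ↔
      IsConflationMap (freeEnvelopeMap M) (cosyzygyπ M) (freeEnvelopeMap N) (cosyzygyπ N) f g :=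
  exists_congr fun _ => ⟨fun h => ⟨h.2.symm, h.1.symm⟩, fun h => ⟨h.2.symm, h.1.symm⟩⟩

lemma restrictsToEquivalence_syzygy : RestrictsToEquivalence (syzygy R) where
  gProj_obj X h := GProj.syzygyObj h
  map_bijective X Y hX hY := by
    have cX := freeConflation_syzygy hX
    have cY := freeConflation_syzygy hY
    constructor
    · intro f f' hff
      obtain ⟨f, rfl⟩ := (toStable R).map_surjective f
      obtain ⟨f', rfl⟩ := (toStable R).map_surjective f'
      obtain ⟨g, hg⟩ := exists_isSyzygyMap f
      obtain ⟨g', hg'⟩ := exists_isSyzygyMap f'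
      have hgg : (toStable R).map g = (toStable R).map g' :=
        (syzygy_map_eq hg).symm.trans (hff.trans (syzygy_map_eq hg'))
      exact (toStable_map_eq_iff f f').2 ((cX.factorsThroughFree_iff cY
        (hg.sub hg')).1 ((toStable_map_eq_iff g g').1 hgg))
    · intro g
      obtain ⟨g, rfl⟩ := (toStable R).map_surjective g
      obtain ⟨f, hf⟩ := cX.exists_right cY g
      exact ⟨(toStable R).map f, syzygy_map_eq hf⟩
  exists_iso Y hY := ⟨(toStable R).obj (cosyzygyObj Y.as), GProj.cosyzygyObj hY,
    (freeConflation_syzygy (GProj.cosyzygyObj hY)).nonempty_iso_left (freeConflation_cosyzygy hY)⟩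

lemma restrictsToEquivalence_cosyzygy : RestrictsToEquivalence (cosyzygy R) where
  gProj_obj X h := GProj.cosyzygyObj h
  map_bijective X Y hX hY := by
    have cX := freeConflation_cosyzygy hX
    have cY := freeConflation_cosyzygy hY
    constructor
    · intro f f' hff
      obtain ⟨f, rfl⟩ := (toStable R).map_surjective f
      obtain ⟨f', rfl⟩ := (toStable R).map_surjective f'
      obtain ⟨g, hg⟩ := exists_isCosyzygyMap f
      obtain ⟨g', hg'⟩ := exists_isCosyzygyMap f'
      have hgg : (toStable R).map g = (toStable R).map g' :=
        (cosyzygy_map_eq hg).symm.trans (hff.trans (cosyzygy_map_eq hg'))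
      exact (toStable_map_eq_iff f f').2 ((cX.factorsThroughFree_iff cY
        (isCosyzygyMap_iff.1 (hg.sub hg'))).2 ((toStable_map_eq_iff g g').1 hgg))
    · intro g
      obtain ⟨g, rfl⟩ := (toStable R).map_surjective g
      obtain ⟨f, hf⟩ := cY.exists_left cX.free cX.zero g
      exact ⟨(toStable R).map f, cosyzygy_map_eq (isCosyzygyMap_iff.2 hf)⟩
  exists_iso Y hY := ⟨(toStable R).obj (syzygyObj Y.as), GProj.syzygyObj hY,
    (freeConflation_cosyzygy (GProj.syzygyObj hY)).nonempty_iso_right (freeConflation_syzygy hY)⟩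

lemma restrictsToEquivalence_syzygyPow (i : ℤ) : RestrictsToEquivalence (syzygyPow R i) := by
  cases i with
  | ofNat n => exact restrictsToEquivalence_syzygy.iterFunctor n
  | negSucc n => exact restrictsToEquivalence_cosyzygy.iterFunctor (n + 1)

end StableEquivalence

/-! ### Finitely presented right modules -/

section RightModules

variable {A : Type u} [Category.{v} A] [Preadditive A]

namespace RightMod

/-- The morphism `Hom(-, X) ⟶ F` that corresponds to `x ∈ F X` under the Yoneda lemma. -/
def ofElement (F : RightMod A) {X : A} (x : F.obj.obj (op X)) : representable X ⟶ F :=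
  ObjectProperty.homMk
    { app := fun Y => AddCommGrpCat.ofHom
        { toFun := fun h : Y.unop ⟶ X => F.obj.map h.op x
          map_zero' := congrArg (fun t => t.hom x) (F.obj.map_zero (op X) Y)
          map_add' := fun h h' => congrArg (fun t => t.hom x)
            (F.obj.map_add (f := Quiver.Hom.op h) (g := Quiver.Hom.op h')) }
      naturality := fun Y Z k => by
        ext (h : Y.unop ⟶ X)
        change F.obj.map (k.unop ≫ h).op x = F.obj.map k (F.obj.map h.op x)
        rw [op_comp, F.obj.map_comp]
        rfl }

lemma naturality_apply {F G : RightMod A} (g : F ⟶ G) {X Y : A} (k : Y ⟶ X)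
    (x : F.obj.obj (op X)) :
    g.hom.app (op Y) (F.obj.map k.op x) = G.obj.map k.op (g.hom.app (op X) x) :=
  congrArg (fun t => t.hom x) (g.hom.naturality k.op)

/-- The Yoneda lemma: a morphism out of a representable module is determined by its value on
the identity. -/
lemma hom_apply {F : RightMod A} {X Y : A} (g : representable X ⟶ F) (h : Y ⟶ X) :
    g.hom.app (op Y) h = F.obj.map h.op (g.hom.app (op X) (𝟙 X)) := by
  have h1 := naturality_apply g h (𝟙 X)
  rw [← h1]
  exact congrArg (fun t => g.hom.app (op Y) t) (Category.comp_id h).symm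

lemma hom_ext_apply {F G : RightMod A} {f g : F ⟶ G}
    (h : ∀ (X : A) (x : F.obj.obj (op X)), f.hom.app (op X) x = g.hom.app (op X) x) : f = g := by
  apply ObjectProperty.hom_ext
  ext X x
  exact h X.unop x

/-- The underlying functor of the objectwise cokernel of a morphism of right modules. -/
def cokerFunctor {F G : RightMod A} (g : F ⟶ G) : Aᵒᵖ ⥤ AddCommGrpCat.{v} where
  obj X := AddCommGrpCat.of (G.obj.obj X ⧸ (g.hom.app X).hom.range)
  map {X Y} k := AddCommGrpCat.ofHom (QuotientAddGroup.map (g.hom.app X).hom.range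
    (g.hom.app Y).hom.range (G.obj.map k).hom (by
      rintro _ ⟨x, rfl⟩
      exact ⟨F.obj.map k x, congrArg (fun t => t.hom x) (g.hom.naturality k)⟩))
  map_id X := by
    ext x
    exact congrArg (fun t => QuotientAddGroup.mk' (g.hom.app X).hom.range (t.hom x))
      (G.obj.map_id X)
  map_comp {X Y Z} k l := by
    ext x
    exact congrArg (fun t => QuotientAddGroup.mk' (g.hom.app Z).hom.range (t.hom x))
      (G.obj.map_comp k l)

instance {F G : RightMod A} (g : F ⟶ G) : (cokerFunctor g).Additive where
  map_add {X Y k l} := by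
    ext x
    obtain ⟨x, rfl⟩ := QuotientAddGroup.mk'_surjective (g.hom.app X).hom.range x
    exact congrArg (fun t => QuotientAddGroup.mk' (g.hom.app Y).hom.range (t.hom x))
      (G.obj.map_add (f := k) (g := l))

/-- The cokernel of a morphism of right modules. -/
def coker {F G : RightMod A} (g : F ⟶ G) : RightMod A := AdditiveFunctor.of (cokerFunctor g)

/-- The projection onto the cokernel. -/
def cokerπ {F G : RightMod A} (g : F ⟶ G) : G ⟶ coker g :=
  ObjectProperty.homMk
    { app := fun X => AddCommGrpCat.ofHom (QuotientAddGroup.mk' (g.hom.app X).hom.range)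
      naturality := fun _ _ _ => rfl }

lemma cokerπ_surj {F G : RightMod A} (g : F ⟶ G) : Surj (cokerπ g) := fun _ =>
  QuotientAddGroup.mk_surjective

lemma cokerπ_exact {F G : RightMod A} (g : F ⟶ G) : Exact g (cokerπ g) := fun Y x =>
  QuotientAddGroup.eq_zero_iff (N := (g.hom.app Y).hom.range) x

lemma finitelyPresented.finitelyGenerated {F : RightMod A} (h : finitelyPresented F) :
    finitelyGenerated F := by
  obtain ⟨_, X, _, g, _, hg⟩ := h
  exact ⟨X, g, hg⟩

/-- The cokernel of a morphism from a finitely generated to a finitely presented module is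
finitely presented: the generators of the source become additional relations. -/
lemma finitelyPresented.coker [Limits.HasBinaryBiproducts A] {F G : RightMod A} (g : F ⟶ G)
    (hF : RightMod.finitelyGenerated F) (hG : finitelyPresented G) :
    finitelyPresented (coker g) := by
  obtain ⟨Y, p, hp⟩ := hF
  obtain ⟨X₁, X₀, f, q, hfq, hq⟩ := hG
  obtain ⟨k, hk⟩ := hq _ (g.hom.app (op Y) (p.hom.app (op Y) (𝟙 Y)))
  let f₁ : X₁ ⟶ X₀ := f.hom.app (op X₁) (𝟙 X₁)
  let k' : Y ⟶ X₀ := k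
  have hfv : ∀ {Z : A} (h : Z ⟶ X₁), f.hom.app (op Z) h = h ≫ f₁ := fun h => hom_apply f h
  have hqk : ∀ {Z : A} (h : Z ⟶ Y), q.hom.app (op Z) (h ≫ k') =
      g.hom.app (op Z) (p.hom.app (op Z) h) := fun h => by
    have h1 := naturality_apply q h k
    rw [hk, ← naturality_apply g h, ← hom_apply p h] at h1
    exact h1
  refine ⟨X₁ ⊞ Y, X₀, ofElement (representable X₀) (Limits.biprod.desc f₁ k' : X₁ ⊞ Y ⟶ X₀),
    q ≫ cokerπ g, fun Z u => ?_, fun Z => (cokerπ_surj g Z).comp (hq Z)⟩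
  change (cokerπ g).hom.app Z (q.hom.app Z u) = 0 ↔ _
  rw [cokerπ_exact g Z]
  constructor
  · rintro ⟨x, hx⟩
    obtain ⟨h, rfl⟩ := hp _ x
    let h' : Z.unop ⟶ Y := h
    let u' : Z.unop ⟶ X₀ := u
    have h1 : q.hom.app Z (u' - h' ≫ k' : Z.unop ⟶ X₀) = 0 := by
      have h2 := map_sub (q.hom.app Z).hom u' (h' ≫ k' : Z.unop ⟶ X₀)
      refine h2.trans (sub_eq_zero.2 ?_)
      exact hx.symm.trans (hqk h').symm
    obtain ⟨l, hl⟩ := (hfq Z _).1 h1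
    let l' : Z.unop ⟶ X₁ := l
    have hl' : l' ≫ f₁ = u' - h' ≫ k' := (hfv l').symm.trans hl
    refine ⟨(Limits.biprod.lift l' h' : Z.unop ⟶ X₁ ⊞ Y), ?_⟩
    change Limits.biprod.lift l' h' ≫ Limits.biprod.desc f₁ k' = u'
    rw [Limits.biprod.lift_desc, hl', sub_add_cancel]
  · rintro ⟨h, rfl⟩
    let h' : Z.unop ⟶ X₁ ⊞ Y := h
    refine ⟨p.hom.app Z (h' ≫ Limits.biprod.snd : Z.unop ⟶ Y), ?_⟩
    refine (hqk (h' ≫ Limits.biprod.snd)).symm.trans ?_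
    change _ = q.hom.app Z (h' ≫ Limits.biprod.desc f₁ k' : Z.unop ⟶ X₀)
    have h1 : h' ≫ Limits.biprod.desc f₁ k' =
        (h' ≫ Limits.biprod.fst) ≫ f₁ + (h' ≫ Limits.biprod.snd) ≫ k' := by
      rw [Limits.biprod.desc_eq, Preadditive.comp_add, Category.assoc, Category.assoc]
    have h2 : q.hom.app Z ((h' ≫ Limits.biprod.fst) ≫ f₁ : Z.unop ⟶ X₀) = 0 :=
      (hfq Z _).2 ⟨(h' ≫ Limits.biprod.fst : Z.unop ⟶ X₁), hfv _⟩
    rw [h1]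
    refine Eq.symm ((map_add (q.hom.app Z).hom ((h' ≫ Limits.biprod.fst) ≫ f₁ : Z.unop ⟶ X₀)
      ((h' ≫ Limits.biprod.snd) ≫ k' : Z.unop ⟶ X₀)).trans ?_)
    refine (congrArg (· + _) h2).trans (zero_add _)

/-- An epimorphism of `mod A` is objectwise surjective, since its cokernel is again finitely
presented. -/
lemma surj_of_epi [Limits.HasBinaryBiproducts A]
    {F G : (finitelyPresented (A := A)).FullSubcategory} (g : F ⟶ G) [Epi g] : Surj g.hom := by
  have hc := finitelyPresented.coker g.hom F.property.finitelyGenerated G.property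
  let π : G ⟶ ⟨_, hc⟩ := ObjectProperty.homMk (cokerπ g.hom)
  let z : G ⟶ ⟨_, hc⟩ := ObjectProperty.homMk 0
  have h1 : g ≫ π = g ≫ z := by
    apply ObjectProperty.hom_ext
    apply hom_ext_apply
    intro X x
    exact (cokerπ_exact g.hom (op X) _).2 ⟨x, rfl⟩
  have h2 : π = z := (cancel_epi g).1 h1
  intro Y y
  refine (cokerπ_exact g.hom Y y).1 ?_
  have h3 : cokerπ g.hom = 0 := congrArg (fun t => t.hom) h2
  rw [h3]
  rfl

/-- A right module isomorphic to a representable one is a projective object of `mod A`. -/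
theorem projectiveInFP_of_bijective [Limits.HasBinaryBiproducts A] {F : RightMod A} {X : A}
    (g : representable X ⟶ F) (hg : ∀ Y, Function.Bijective (g.hom.app Y)) : projectiveInFP F := by
  have hF : finitelyPresented F := by
    refine ⟨X, X, 0, g, fun Y x => ?_, fun Y => (hg Y).2⟩
    rw [← map_zero (g.hom.app Y).hom]
    constructor
    · intro h
      exact ⟨0, ((hg Y).1 h).symm⟩
    · rintro ⟨y, rfl⟩
      rfl
  refine ⟨hF, ⟨fun {E G} f e he => ?_⟩⟩
  have hs := surj_of_epi e
  obtain ⟨y, hy⟩ := hs _ (f.hom.hom.app (op X) (g.hom.app (op X) (𝟙 X)))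
  let γ : ∀ Y, F.obj.obj Y ≃+ (representable X).obj.obj Y := fun Y =>
    (AddEquiv.ofBijective (g.hom.app Y).hom (hg Y)).symm
  have hγ : ∀ Y x, g.hom.app Y (γ Y x) = x := fun Y x =>
    (AddEquiv.ofBijective (g.hom.app Y).hom (hg Y)).apply_symm_apply x
  let ginv : F ⟶ representable X := ObjectProperty.homMk
    { app := fun Y => AddCommGrpCat.ofHom (γ Y).toAddMonoidHom
      naturality := fun Y Z k => by
        ext x
        refine (hg Z).1 ?_
        refine (hγ Z _).trans ?_
        refine Eq.trans ?_ (naturality_apply g k.unop (γ Y x)).symm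
        exact congrArg (F.obj.map k) (hγ Y x).symm }
  refine ⟨ObjectProperty.homMk (ginv ≫ ofElement E.obj y), ?_⟩
  apply ObjectProperty.hom_ext
  apply hom_ext_apply
  intro Y x
  obtain ⟨h, rfl⟩ := (hg (op Y)).2 x
  have h1 : γ (op Y) (g.hom.app (op Y) h) = h := (hg (op Y)).1 (hγ _ _)
  change e.hom.hom.app (op Y)
    ((ofElement E.obj y).hom.app (op Y) (γ (op Y) (g.hom.app (op Y) h))) = _
  rw [h1]
  have h2 : e.hom.hom.app (op Y) (E.obj.obj.map (Quiver.Hom.op (h : Y ⟶ X)) y) = _ :=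
    naturality_apply e.hom (h : Y ⟶ X) y
  refine h2.trans ?_
  rw [hy, hom_apply g (h : Y ⟶ X)]
  exact (naturality_apply f.hom (h : Y ⟶ X) _).symm

end RightMod

end RightModules

/-! ### Minimal approximations by G-projective modules -/

section Approximation

variable {R : Type u} [CommRing R]

lemma freeMod.gProj {F : FGModuleCat.{u} R} (hF : freeMod R F) : GProj R F :=
  have : Module.Free R F := hF
  IsGProj.of_free F

/-- The biproduct in the stable category is the direct sum of modules. -/
instance : Limits.HasBinaryBiproducts (StableCat (GProj R)) where
  has_binary_biproduct X Y := by
    let S : FGModuleCat.{u} R := FGModuleCat.of R (X.obj.as × Y.obj.as)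
    let p : S ⟶ X.obj.as := FGModuleCat.ofHom (LinearMap.fst R _ _)
    let q : S ⟶ Y.obj.as := FGModuleCat.ofHom (LinearMap.snd R _ _)
    let i : X.obj.as ⟶ S := FGModuleCat.ofHom (LinearMap.inl R _ _)
    let j : Y.obj.as ⟶ S := FGModuleCat.ofHom (LinearMap.inr R _ _)
    have hip : i ≫ p = 𝟙 _ := rfl
    have hiq : i ≫ q = 0 := rfl
    have hjp : j ≫ p = 0 := rfl
    have hjq : j ≫ q = 𝟙 _ := rfl
    have htot : p ≫ i + q ≫ j = 𝟙 S := ConcreteCategory.hom_ext _ _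
      fun x : X.obj.as × Y.obj.as => congrArg₂ Prod.mk (add_zero x.1) (zero_add x.2)
    exact Limits.hasBinaryBiproduct_of_total
      { pt := ⟨(toStable R).obj S, IsGProj.prod X.property Y.property⟩
        fst := ObjectProperty.homMk ((toStable R).map p)
        snd := ObjectProperty.homMk ((toStable R).map q)
        inl := ObjectProperty.homMk ((toStable R).map i)
        inr := ObjectProperty.homMk ((toStable R).map j)
        inl_fst := ObjectProperty.hom_ext _ (congrArg (toStable R).map hip)
        inl_snd := ObjectProperty.hom_ext _ (congrArg (toStable R).map hiq)
        inr_fst := ObjectProperty.hom_ext _ (congrArg (toStable R).map hjp)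
        inr_snd := ObjectProperty.hom_ext _ (congrArg (toStable R).map hjq) }
      (ObjectProperty.hom_ext _ (congrArg (toStable R).map htot))

/-- Over a Henselian local ring, a module with a right approximation by a G-projective module has a
right minimal one. -/
theorem exists_rightMinimal_approximation [IsNoetherianRing R] [HenselianLocalRing R]
    {M : FGModuleCat.{u} R} (hM : rap (GProj R) M) :
    ∃ (X : FGModuleCat.{u} R) (φ : X ⟶ M), IsRightApproximation (GProj R) φ ∧ IsRightMinimal φ := by
  obtain ⟨X, φ, hX, hφ⟩ := hM
  obtain ⟨e, he, hφe, hmin⟩ := exists_isIdempotentElem_rightMinimal φ.hom.hom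
  let ι : FGModuleCat.of R (LinearMap.range e) ⟶ X := FGModuleCat.ofHom (LinearMap.range e).subtype
  refine ⟨FGModuleCat.of R (LinearMap.range e), ι ≫ φ, ⟨?_, fun Y hY ψ => ?_⟩, fun f hf => ?_⟩
  · refine IsGProj.of_retract (B := X) hX (LinearMap.range e).subtype e.rangeRestrict ?_
    ext ⟨_, y, rfl⟩
    exact LinearMap.congr_fun he y
  · obtain ⟨f, rfl⟩ := hφ hY ψ
    refine ⟨f ≫ FGModuleCat.ofHom e.rangeRestrict, ?_⟩
    ext y
    exact LinearMap.congr_fun hφe (f.hom.hom y)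
  · exact FGModuleCat.isIso_of_bijective f (hmin f.hom.hom fun y => FGModuleCat.congr_hom hf y)

variable [IsNoetherianRing R] [IsLocalRing R]

/-- A form of Wakamatsu's lemma. If `k : Y ⟶ X` is killed by the minimal approximation `φ`, the
pushout `P` of `k` and the free envelope `Y ⟶ E` is G-projective and `φ` extends to `P`. The
extension factors through `φ`, and by minimality the factorization is a retraction onto `X` up to an
automorphism; hence `k` factors through `E`. -/
theorem factorsThroughFree_of_comp_eq_zero {X M : FGModuleCat.{u} R} {φ : X ⟶ M}
    (hφ : IsRightApproximation (GProj R) φ) (hmin : IsRightMinimal φ) {Y : FGModuleCat.{u} R}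
    (hY : GProj R Y) (k : Y ⟶ X) (hk : k ≫ φ = 0) : FactorsThroughFree k := by
  have hc := freeConflation_cosyzygy hY
  let j : Y ⟶ freeEnvelope Y := freeEnvelopeMap Y
  let L : Y →ₗ[R] X × freeEnvelope Y := k.hom.hom.prod j.hom.hom
  let P : FGModuleCat.{u} R := FGModuleCat.of R ((X × freeEnvelope Y) ⧸ LinearMap.range L)
  have hP : GProj R P := by
    refine IsGProj.right (f := L) (g := (LinearMap.range L).mkQ)
      (fun a b hab => hc.injective (congrArg Prod.snd hab))
      (fun x => Submodule.Quotient.mk_eq_zero _) (Submodule.mkQ_surjective _) hY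
      (IsGProj.prod hφ.1 hc.isGProj_middle) fun a => ?_
    obtain ⟨b, rfl⟩ := hc.dualMap_surjective a
    exact ⟨b ∘ₗ LinearMap.snd R X (freeEnvelope Y), rfl⟩
  let ψ : P ⟶ M := FGModuleCat.ofHom ((LinearMap.range L).liftQ
    (φ.hom.hom ∘ₗ LinearMap.fst R X (freeEnvelope Y)) (by
      rintro _ ⟨y, rfl⟩
      exact FGModuleCat.congr_hom hk y))
  obtain ⟨r, hr⟩ := hφ.2 hP ψ
  let g : X ⟶ X :=
    FGModuleCat.ofHom ((LinearMap.range L).mkQ ∘ₗ LinearMap.inl R X (freeEnvelope Y)) ≫ r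
  let s : freeEnvelope Y ⟶ X :=
    FGModuleCat.ofHom ((LinearMap.range L).mkQ ∘ₗ LinearMap.inr R X (freeEnvelope Y)) ≫ r
  have hg : g ≫ φ = φ := by
    rw [Category.assoc, hr]
    rfl
  have := hmin g hg
  have hks : k ≫ g + j ≫ s = 0 := by
    ext y
    change r.hom.hom ((LinearMap.range L).mkQ (k.hom.hom y, 0)) +
      r.hom.hom ((LinearMap.range L).mkQ (0, j.hom.hom y)) = 0
    rw [← map_add, ← map_add, Prod.mk_add_mk, add_zero, zero_add]
    have h1 : (LinearMap.range L).mkQ (k.hom.hom y, j.hom.hom y) = 0 :=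
      (Submodule.Quotient.mk_eq_zero _).2 ⟨y, rfl⟩
    rw [h1, map_zero]
  refine ⟨freeEnvelope Y, hc.free, j, -(s ≫ inv g), ?_⟩
  rw [← cancel_mono g, Preadditive.comp_neg, Preadditive.neg_comp, Category.assoc, Category.assoc,
    IsIso.inv_hom_id, Category.comp_id]
  exact (eq_neg_of_add_eq_zero_left hks).symm

/-- A minimal right approximation `X ⟶ M` induces bijections on stable homomorphism groups out of
G-projective modules. -/
theorem stable_comp_bijective {X M : FGModuleCat.{u} R} {φ : X ⟶ M}
    (hφ : IsRightApproximation (GProj R) φ) (hmin : IsRightMinimal φ) {Y : FGModuleCat.{u} R}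
    (hY : GProj R Y) : Function.Bijective fun f : (toStable R).obj Y ⟶ (toStable R).obj X =>
      f ≫ (toStable R).map φ := by
  constructor
  · intro f f' hff
    obtain ⟨f, rfl⟩ := (toStable R).map_surjective f
    obtain ⟨f', rfl⟩ := (toStable R).map_surjective f'
    have h1 : (toStable R).map (f ≫ φ) = (toStable R).map (f' ≫ φ) := hff
    rw [toStable_map_eq_iff] at h1 ⊢
    obtain ⟨F, hF, b, c, hbc⟩ := h1
    obtain ⟨c', rfl⟩ := hφ.2 hF.gProj c
    have h2 := factorsThroughFree_of_comp_eq_zero hφ hmin hY (f - f' - b ≫ c') (by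
      rw [Preadditive.sub_comp, Preadditive.sub_comp, ← hbc, Category.assoc, sub_self])
    have h3 := FactorsThroughFree.add h2 ⟨F, hF, b, c', rfl⟩
    rwa [sub_add_cancel] at h3
  · intro g
    obtain ⟨g, rfl⟩ := (toStable R).map_surjective g
    obtain ⟨f, rfl⟩ := hφ.2 hY g
    exact ⟨(toStable R).map f, ((toStable R).map_comp _ _).symm⟩

/-- If `M` has a minimal right approximation by a G-projective module, all its Tate cohomology
functors are representable, hence projective in the category of finitely presented modules. -/
theorem projectiveInFP_tateExt {X M : FGModuleCat.{u} R} {φ : X ⟶ M}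
    (hφ : IsRightApproximation (GProj R) φ) (hmin : IsRightMinimal φ) (i : ℤ) :
    RightMod.projectiveInFP (tateExt i M) := by
  have hT := restrictsToEquivalence_syzygyPow (R := R) i
  obtain ⟨X', hX', ⟨θ⟩⟩ := hT.exists_iso ((toStable R).obj X) hφ.1
  let Z : StableCat (GProj R) := ⟨X', hX'⟩
  let x : (tateExt i M).obj.obj (op Z) :=
    (θ.hom ≫ (toStable R).map φ : (syzygyPow R i).obj X' ⟶ (toStable R).obj M)
  refine RightMod.projectiveInFP_of_bijective (RightMod.ofElement _ x) fun Y => ?_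
  have h1 : Function.Bijective fun h : Y.unop ⟶ Z => h.hom :=
    ⟨fun _ _ h => ObjectProperty.hom_ext _ h, fun h => ⟨ObjectProperty.homMk h, rfl⟩⟩
  have h2 := hT.map_bijective Y.unop.obj X' Y.unop.property hX'
  have h3 : Function.Bijective fun f : (syzygyPow R i).obj Y.unop.obj ⟶ (syzygyPow R i).obj X' =>
      f ≫ θ.hom := θ.homToEquiv.bijective
  have h4 := stable_comp_bijective hφ hmin (hT.gProj_obj _ Y.unop.property)
  have h5 := h4.comp (h3.comp (h2.comp h1))
  refine Eq.mp (congrArg Function.Bijective (funext fun h => ?_)) h5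
  exact Category.assoc _ _ _

/-- If some Tate cohomology functor of `M` is finitely generated, a generator yields a stable
approximation `Ωⁱ X ⟶ M`, which becomes an approximation after adding the free cover of `M`. -/
theorem rap_of_finitelyGenerated_tateExt {M : FGModuleCat.{u} R} (i : ℤ)
    (h : RightMod.finitelyGenerated (tateExt i M)) : rap (GProj R) M := by
  obtain ⟨X, g, hg⟩ := h
  have hT := restrictsToEquivalence_syzygyPow (R := R) i
  have hX : GProj R ((syzygyPow R i).obj X.obj).as := hT.gProj_obj _ X.property
  let α : (syzygyPow R i).obj X.obj ⟶ (toStable R).obj M := g.hom.app (op X) (𝟙 X)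
  obtain ⟨α₀, hα₀⟩ : ∃ a : ((syzygyPow R i).obj X.obj).as ⟶ M, (toStable R).map a = α :=
    (toStable R).map_surjective α
  refine ⟨FGModuleCat.of R (((syzygyPow R i).obj X.obj).as × freeCover M),
    FGModuleCat.ofHom (α₀.hom.hom.coprod (freeCoverMap M).hom.hom),
    IsGProj.prod hX (freeCoverMap_isRightApproximation M).1.gProj, fun Y hY β => ?_⟩
  obtain ⟨Y', hY', ⟨e⟩⟩ := hT.exists_iso ((toStable R).obj Y) hY
  obtain ⟨γ, hγ⟩ := hg (op (⟨Y', hY'⟩ : StableCat (GProj R)))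
    (e.hom ≫ (toStable R).map β : (syzygyPow R i).obj Y' ⟶ (toStable R).obj M)
  let γ' : (⟨Y', hY'⟩ : StableCat (GProj R)) ⟶ X := γ
  have h1 : (syzygyPow R i).map γ'.hom ≫ α = e.hom ≫ (toStable R).map β :=
    (RightMod.hom_apply g γ').symm.trans hγ
  obtain ⟨δ, hδ⟩ : ∃ d : Y ⟶ ((syzygyPow R i).obj X.obj).as,
      (toStable R).map d = e.inv ≫ (syzygyPow R i).map γ'.hom :=
    (toStable R).map_surjective _
  have h2 : (toStable R).map β = (toStable R).map (δ ≫ α₀) := by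
    refine Eq.trans ?_ ((toStable R).map_comp δ α₀).symm
    rw [hδ, hα₀]
    refine Eq.trans ?_ (Category.assoc _ _ _).symm
    rw [h1]
    exact (Iso.inv_hom_id_assoc e _).symm
  obtain ⟨F, hF, b, c, hbc⟩ := (toStable_map_eq_iff _ _).1 h2
  obtain ⟨c', rfl⟩ := (freeCoverMap_isRightApproximation M).2 hF c
  refine ⟨FGModuleCat.ofHom (δ.hom.hom.prod (b ≫ c').hom.hom), ?_⟩
  have h3 : β = δ ≫ α₀ + (b ≫ c') ≫ freeCoverMap M := by
    rw [Category.assoc, hbc, add_sub_cancel]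
  rw [h3]
  rfl

end Approximation

end

theorem mainTheorem2 {R : Type u} [CommRing R] [IsNoetherianRing R] [HenselianLocalRing R]
    (M : FGModuleCat.{u} R) :
    List.TFAE [
      rap (GProj R) M,
      ∀ i : ℤ, RightMod.finitelyGenerated (tateExt i M),
      ∃ i : ℤ, RightMod.finitelyGenerated (tateExt i M),
      ∀ i : ℤ, RightMod.finitelyPresented (tateExt i M),
      ∃ i : ℤ, RightMod.finitelyPresented (tateExt i M),
      ∀ i : ℤ, RightMod.projectiveInFP (tateExt i M),
      ∃ i : ℤ, RightMod.projectiveInFP (tateExt i M)] := by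
  tfae_have 1 → 6 := fun h i => by
    obtain ⟨X, φ, hφ, hmin⟩ := exists_rightMinimal_approximation h
    exact projectiveInFP_tateExt hφ hmin i
  tfae_have 6 → 4 := fun h i => (h i).1
  tfae_have 4 → 2 := fun h i => (h i).finitelyGenerated
  tfae_have 2 → 3 := fun h => ⟨0, h 0⟩
  tfae_have 6 → 7 := fun h => ⟨0, h 0⟩
  tfae_have 7 → 5 := fun ⟨i, h⟩ => ⟨i, h.1⟩
  tfae_have 5 → 3 := fun ⟨i, h⟩ => ⟨i, h.finitelyGenerated⟩
  tfae_have 3 → 1 := fun ⟨i, h⟩ => rap_of_finitelyGenerated_tateExt i h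
  tfae_finish
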